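/- Write $f(t)\sim g(t)$ as $t\to\infty$ when $f(t)/g(t)$ converges to some constant $c\in(0,\infty)$ (not necessarily $1$). Let $m,\beta>0$ and let $K:\mathbb R\to\mathbb R\cup\{\infty\}$, possibly infinite only at $0$, satisfy: $K\in L^1_{loc}(\mathbb R)$, $K$ is even and $K(t)>0$ for $t\neq0$; $K(t)\to0$ as $t\to\infty$ and $K$ is eventually decreasing; for every $\omega\ne0$ the improper integral $\int_0^\infty K(t)\cos(\omega t)\,dt$ is positive; and $K(t)\sim t^{-1}$ as $t\to\infty$. Notation: $\widehat\varphi(\omega)=\int_{\mathbb R} e^{it\omega}\varphi(t)\,dt$ for Schwartz functions $\varphi\in\mathcal S$ (complex-valued), $\mathcal F$ is the corresponding transform on tempered distributions $\mathcal S'$, $\langle\mathcal F[g],\varphi\rangle=\langle g,\widehat\varphi\rangle$, $\widetilde f(t)=f(-t)$, and $K^+=K\,1_{[0,\infty)}$. Let $\nu$ be a nonnegative measure on $\mathbb R$, absolutely continuous with respect to Lebesgue measure, with $\int(1+x^2)^{-k}\,\nu(dx)<\infty$ for some integer $k$. Let $\mathrm{Dom}(V)$ be the set of $g\in\mathcal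 S'$ such that $\mathcal F[g]$ is a complex-valued (locally integrable) function belonging to $L^2(\nu)$, and let $V$ be a linear operator from $\mathrm{Dom}(V)$ to the square-integrable complex random variables on a probability space, whose values form a Gaussian family, with $$\mathbb E\big[\langle V,g_1\rangle\overline{\langle V,g_2\rangle}\big]=\int_{\mathbb R}\mathcal F[g_1](\omega)\,\overline{\mathcal F[g_2](\omega)}\,\nu(d\omega),\qquad g_1,g_2\in \mathrm{Dom}(V).$$ Suppose that $V$ is a weak solution of the generalized Langevin equation $m\dot V(t)=-\beta\int_{-\infty}^tK(t-s)V(s)\,ds+\sqrt\beta\,F(t)$, where $F$ is stationary with $\mathbb E[F(t)F(s)]=K(t-s)$; that is, (a) $K^+*\varphi\in\mathrm{Dom}(V)$ for every $\varphi\in\mathcal S$, and (b) for all $\varphi,\psi\in\mathcal S$, $$\mathbb E\Big[\big\langle V,-m\varphi'+\beta\,\widetilde{K^+*\widetilde\varphi}\big\rangle\overline{\big\langle V,-m\psi'+\beta\,\widetilde{K^+*\widetilde\psi}\big\rangle}\Big]=\beta\int_{\mathbb R}K(t)\,\big(\varphi*\psi^*\big)(t)\,dt,\qquad \psi^*(t)=\overline{\psi(-t)}.$$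 Then $1_{[0,t]}\in\mathrm{Dom}(V)$ for every $t\ge0$, and the position process $X(t)=\langle V,1_{[0,t]}\rangle$ satisfies $$\mathbb E\big[|X(t)|^2\big]\sim\frac{t}{\log t}\qquad\text{as }t\to\infty$$ (when $X$ is real-valued this is $\mathbb E[X(t)^2]\sim t/\log t$). -/

import Mathlib

open MeasureTheory ProbabilityTheory Filter Topology
open scoped SchwartzMap FourierTransform ComplexConjugate

noncomputable section

namespace GLE

/-- `f ∼ g` along `l`: the quotient `f / g` converges to a finite, strictly positive constant
(which is not required to be `1`). -/
def AsympUpToConst (f g : ℝ → ℝ) (l : Filter ℝ) : Prop :=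
  ∃ c : ℝ, 0 < c ∧ Tendsto (fun t => f t / g t) l (𝓝 c)

/-- Standing conditions on the memory kernel. Nothing is required of the value `K 0`, so kernels
that are infinite at the origin are covered. -/
structure IsMemoryKernel (K : ℝ → ℝ) : Prop where
  locallyIntegrable : LocallyIntegrable K volume
  even : ∀ t, K (-t) = K t
  pos : ∀ t, t ≠ 0 → 0 < K t
  tendsto_zero : Tendsto K atTop (𝓝 0)
  eventually_decreasing : ∃ A : ℝ, AntitoneOn K (Set.Ici A)
  /-- The improper cosine integral converges to a positive number at every nonzero frequency. -/
  cos_transform_pos : ∀ ω : ℝ, ω ≠ 0 → ∃ L : ℝ, 0 < L ∧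
    Tendsto (fun R : ℝ => ∫ t in (0 : ℝ)..R, K t * Real.cos (ω * t)) atTop (𝓝 L)

/-! ### Fourier transform with the kernel `exp (i t ω)` -/

/-- The scaling `ω ↦ - ω / (2π)` that relates the kernel `exp (i t ω)` to Mathlib's
`exp (-2π i t ω)`. -/
def freqScale : ℝ ≃L[ℝ] ℝ :=
  ContinuousLinearEquiv.unitsEquivAut ℝ (Units.mk0 (-(2 * Real.pi)⁻¹) (by
    have := Real.pi_pos
    simp [this.ne']))

/-- The Fourier transform `φ ↦ (ω ↦ ∫ exp (i t ω) φ(t) dt)` on Schwartz functions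
(see `ft_apply`). -/
def ft : 𝓢(ℝ, ℂ) →L[ℂ] 𝓢(ℝ, ℂ) :=
  (SchwartzMap.compCLMOfContinuousLinearEquiv ℂ freqScale).comp
    (FourierTransform.fourierCLM ℂ 𝓢(ℝ, ℂ))

theorem ft_apply (φ : 𝓢(ℝ, ℂ)) (ω : ℝ) :
    ft φ ω = ∫ t : ℝ, Complex.exp (Complex.I * t * ω) * φ t := by
  have h : ft φ ω = 𝓕 (φ : ℝ → ℂ) (freqScale ω) := rfl
  rw [h, Real.fourier_real_eq_integral_exp_smul]
  refine integral_congr_ae (Eventually.of_forall fun t => ?_)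
  have hs : freqScale ω = ω * (-(2 * Real.pi)⁻¹) := by
    simp [freqScale]
  have hpi : (Real.pi : ℂ) ≠ 0 := by exact_mod_cast Real.pi_ne_zero
  simp only [smul_eq_mul, hs]
  congr 2
  push_cast
  field_simp

/-- The Fourier transform on tempered distributions, `⟨𝓕[T], φ⟩ = ⟨T, φ̂⟩`. -/
def ftDist (T : 𝓢'(ℝ, ℂ)) : 𝓢'(ℝ, ℂ) :=
  PointwiseConvergenceCLM.precomp ℂ ft T

theorem ftDist_apply (T : 𝓢'(ℝ, ℂ)) (φ : 𝓢(ℝ, ℂ)) : ftDist T φ = T (ft φ) := rfl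

/-- The function `f` is of slow enough growth to define a tempered distribution by integration
against Schwartz functions, and `T` is this distribution. -/
def IsIntegrationAgainst (T : 𝓢'(ℝ, ℂ)) (f : ℝ → ℂ) : Prop :=
  ∀ φ : 𝓢(ℝ, ℂ), Integrable (fun t => φ t * f t) volume ∧ T φ = ∫ t, φ t * f t

/-- The distribution `T` is (equal, as a distribution, to) the locally integrable function `f`. -/
def IsFunction (T : 𝓢'(ℝ, ℂ)) (f : ℝ → ℂ) : Prop :=
  LocallyIntegrable f volume ∧
    ∀ φ : 𝓢(ℝ, ℂ), HasCompactSupport (φ : ℝ → ℂ) → T φ = ∫ ω, φ ω * f ω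

/-- The domain associated with a spectral measure `ν`: tempered distributions whose Fourier
transform is a complex-valued function lying in `L²(ν)`. -/
def InDom (ν : Measure ℝ) (T : 𝓢'(ℝ, ℂ)) : Prop :=
  ∃ f : ℝ → ℂ, IsFunction (ftDist T) f ∧ MemLp f 2 ν

section Solution

variable {Ω : Type*} [MeasurableSpace Ω]

/-- `V` is the (Gaussian, square-integrable) stationary random operator with spectral measure `ν`.
The measure `ν` is nonnegative, of at most polynomial growth, and absolutely continuous with respect
to Lebesgue measure; `V` is defined on the domain associated with `ν` and satisfies
`E[⟨V, S⟩ conj ⟨V, T⟩] = ∫ 𝓕[S] conj 𝓕[T] dν`. -/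
structure IsStationaryOperator (P : Measure Ω) (ν : Measure ℝ)
    (V : 𝓢'(ℝ, ℂ) →ₗ.[ℂ] Lp ℂ 2 P) : Prop where
  growth : ∃ k : ℕ, ∫⁻ x : ℝ, ENNReal.ofReal (((1 + x ^ 2) ^ k)⁻¹) ∂ν < ⊤
  absolutelyContinuous : ν ≪ volume
  mem_domain : ∀ T : 𝓢'(ℝ, ℂ), T ∈ V.domain ↔ InDom ν T
  gaussian : IsGaussianProcess (fun (T : V.domain) (x : Ω) => (V T : Lp ℂ 2 P) x) P
  covariance : ∀ (S T : V.domain) (f g : ℝ → ℂ),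
    IsFunction (ftDist S) f → IsFunction (ftDist T) g →
      ∫ x, (V S : Lp ℂ 2 P) x * conj ((V T : Lp ℂ 2 P) x) ∂P = ∫ ω, f ω * conj (g ω) ∂ν

/-- The convolution `K⁺ * φ`, where `K⁺(u) = K(u) 1_{u ≥ 0}`. -/
def convPlus (K : ℝ → ℝ) (φ : ℝ → ℂ) (t : ℝ) : ℂ :=
  ∫ u in Set.Ici (0 : ℝ), (K u : ℂ) * φ (t - u)

/-- Reflection, `f̃(t) = f(-t)`. -/
def reflect (f : ℝ → ℂ) (t : ℝ) : ℂ := f (-t)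

/-- The function `-m φ' + β (K⁺ * φ̃)~` to which `V` is applied in the weak form of the equation. -/
def testDrift (m β : ℝ) (K : ℝ → ℝ) (φ : 𝓢(ℝ, ℂ)) (t : ℝ) : ℂ :=
  -(m : ℂ) * deriv (φ : ℝ → ℂ) t + (β : ℂ) * reflect (convPlus K (reflect φ)) t

/-- The covariance `E[⟨F, φ⟩ conj ⟨F, ψ⟩] = ∫ K(t) (φ * ψ*)(t) dt`, with `ψ*(t) = conj ψ(-t)`, of the
stationary forcing `F` prescribed by the fluctuation-dissipation relation `E[F(t) F(s)] = K(t - s)`.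
Since the notion of weak solution involves `F` only through these numbers, they are used
directly. -/
def forcingCov (K : ℝ → ℝ) (φ ψ : 𝓢(ℝ, ℂ)) : ℂ :=
  ∫ t, (K t : ℂ) * ∫ s, φ s * conj (ψ (s - t))

/-- `V`, with spectral measure `ν`, is a weak solution of the generalized Langevin equation
`m V'(t) = -β ∫_{-∞}^t K(t - s) V(s) ds + √β F(t)`. -/
structure IsWeakSolution (m β : ℝ) (K : ℝ → ℝ) (P : Measure Ω) (ν : Measure ℝ)
    (V : 𝓢'(ℝ, ℂ) →ₗ.[ℂ] Lp ℂ 2 P) : Prop where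
  stationary : IsStationaryOperator P ν V
  /-- `K⁺ * φ` is a tempered distribution in the domain of `V`. -/
  conv_mem : ∀ φ : 𝓢(ℝ, ℂ), ∃ T ∈ V.domain, IsIntegrationAgainst T (convPlus K φ)
  /-- `E[⟨V, -mφ' + β(K⁺*φ̃)~⟩ conj ⟨V, -mψ' + β(K⁺*ψ̃)~⟩] = E[⟨√β F, φ⟩ conj ⟨√β F, ψ⟩]`.
  Under `growth` and `conv_mem` the two arguments of `V` do lie in its domain. -/
  weak_eq : ∀ (φ ψ : 𝓢(ℝ, ℂ)) (S T : V.domain),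
    IsIntegrationAgainst S (testDrift m β K φ) → IsIntegrationAgainst T (testDrift m β K ψ) →
      ∫ x, (V S : Lp ℂ 2 P) x * conj ((V T : Lp ℂ 2 P) x) ∂P = (β : ℂ) * forcingCov K φ ψ

/-- The indicator function of `[0, t]` as a tempered distribution. -/
def indicatorDist (t : ℝ) : 𝓢'(ℝ, ℂ) :=
  Lp.toTemperedDistribution
    (indicatorConstLp (μ := (volume : Measure ℝ)) 1 (s := Set.Icc 0 t) measurableSet_Icc
      measure_Icc_lt_top.ne (1 : ℂ))

open Classical in
/-- The position process `X(t) = ⟨V, 1_{[0,t]}⟩` (with the value `0` if the indicator is not in the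
domain of `V`; that it is in the domain is a separate claim). -/
def position {P : Measure Ω} (V : 𝓢'(ℝ, ℂ) →ₗ.[ℂ] Lp ℂ 2 P) (t : ℝ) : Lp ℂ 2 P :=
  if h : indicatorDist t ∈ V.domain then V ⟨indicatorDist t, h⟩ else 0

end Solution

end GLE

end

/-!
Write `k(ω) = ∫_0^∞ K(t) exp (i t ω) dt` for the half-line transform of the kernel, an improper
integral that exists for `ω ≠ 0` because `K` is eventually decreasing (`halfFT`). In the frequency
domain the operator `φ ↦ -mφ' + β (K⁺ * φ̃)~` is multiplication by the symbol
`σ(ω) = i m ω + β k(-ω)`, and `K`, being even, has transform `2 Re k`. The weak equation therefore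
says that `|σ|² ν` and `(β / π) Re k dω` have the same integrals against test functions
(`TailBound.integral_symbol_sq`). As `Re σ = β Re k > 0` off the origin and `ν` does not charge the
origin, `ν` has the density `r = (β / π) Re k / |σ|²` (`TailBound.rnDeriv_ae_eq`).

Let `c` be the limit of `t K(t)`. Up to a bounded error, `k(ω)` is the primitive of `K` at
`1 / |ω|`, since the integrand barely oscillates before time `1 / |ω|` and cancels afterwards.
Hence `k(ω) / log (1 / |ω|) → c`, and `r(ω) log (1 / |ω|) → 1 / (π β c)` as `ω → 0`
(`TailBound.tendsto_spectralDensity_mul_log`). At infinity the inertial term `i m ω` dominates the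
symbol, and in between `r` is continuous, so `r(ω)` and `r(ω) log⁺ (1 / |ω|)` are bounded
(`TailBound.exists_spectralDensity_le`).

Consequently the transform `e_t` of `1_{[0,t]}` is square-integrable for `ν`, and
`E |X(t)|² = ∫ r |e_t|²`. From `e_t(ω) = t e_1(t ω)`, the substitution `ω = x / t` gives
`E |X(t)|² = t ∫ r(x / t) |e_1(x)|² dx`. After multiplication by `log t / t` the integrand converges
to `|e_1(x)|² / (π β c)`, dominated by a multiple of `|e_1(x)|² (1 + log⁺ |x|)`
(`tendsto_integral_mul_indicatorFT_sq`).
-/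

namespace GLE

/-! ### The characters -/

/-- The character `t ↦ exp (i ω t)`. -/
noncomputable def expI (ω t : ℝ) : ℂ := Complex.exp (Complex.I * t * ω)

theorem norm_expI (ω t : ℝ) : ‖expI ω t‖ = 1 := by
  have : Complex.I * t * ω = ((t * ω : ℝ) : ℂ) * Complex.I := by push_cast; ring
  rw [expI, this, Complex.norm_exp_ofReal_mul_I]

theorem expI_re (ω t : ℝ) : (expI ω t).re = Real.cos (ω * t) := by
  have : Complex.I * t * ω = ((ω * t : ℝ) : ℂ) * Complex.I := by push_cast; ring
  rw [expI, this, Complex.exp_ofReal_mul_I_re]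

theorem expI_neg_left (ω t : ℝ) : expI (-ω) t = conj (expI ω t) := by
  rw [expI, expI, ← Complex.exp_conj]
  congr 1
  simp

theorem expI_neg_right (ω t : ℝ) : expI ω (-t) = expI (-ω) t := by
  simp [expI]

theorem expI_add (ω s t : ℝ) : expI ω (s + t) = expI ω s * expI ω t := by
  rw [expI, expI, expI, ← Complex.exp_add]
  congr 1
  push_cast; ring

theorem continuous_expI : Continuous fun p : ℝ × ℝ => expI p.1 p.2 := by
  unfold expI; fun_prop

@[fun_prop]
theorem continuous_expI_right (ω : ℝ) : Continuous (expI ω) := by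
  unfold expI; fun_prop

@[fun_prop]
theorem continuous_expI_left (t : ℝ) : Continuous (fun ω => expI ω t) := by
  unfold expI; fun_prop

/-- Translation by half a period changes the sign of the character. -/
theorem expI_add_half_period {ω : ℝ} (hω : ω ≠ 0) (t : ℝ) :
    expI ω (t + Real.pi / |ω|) = - expI ω t := by
  rw [expI_add]
  have : expI ω (Real.pi / |ω|) = -1 := by
    rcases lt_or_gt_of_ne hω with h | h
    · have e : Complex.I * ((Real.pi / |ω| : ℝ) : ℂ) * ω = -(Real.pi * Complex.I) := by
        rw [abs_of_neg h]
        have : (ω : ℂ) ≠ 0 := by exact_mod_cast hω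
        push_cast; field_simp
      rw [expI, e, Complex.exp_neg, Complex.exp_pi_mul_I]; norm_num
    · have e : Complex.I * ((Real.pi / |ω| : ℝ) : ℂ) * ω = (Real.pi * Complex.I) := by
        rw [abs_of_pos h]
        have : (ω : ℂ) ≠ 0 := by exact_mod_cast hω
        push_cast; field_simp
      rw [expI, e, Complex.exp_pi_mul_I]
  rw [this]; ring

theorem norm_expI_sub_one_le (ω t : ℝ) : ‖expI ω t - 1‖ ≤ |ω * t| := by
  have : Complex.I * t * ω = Complex.I * ((ω * t : ℝ) : ℂ) := by push_cast; ring
  rw [expI, this]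
  exact Real.norm_exp_I_mul_ofReal_sub_one_le

/-! ### Oscillatory integrals of kernels with monotone tail -/

/-- The truncated half-line transform `∫_0^R K(t) exp (i ω t) dt`. -/
noncomputable def truncFT (K : ℝ → ℝ) (R ω : ℝ) : ℂ := ∫ t in (0 : ℝ)..R, (K t : ℂ) * expI ω t

/-- The half-line transform `∫_0^∞ K(t) exp (i ω t) dt`, as an improper integral. -/
noncomputable def halfFT (K : ℝ → ℝ) (ω : ℝ) : ℂ := limUnder atTop fun R => truncFT K R ω

variable {K : ℝ → ℝ}

theorem intervalIntegrable_kernel (hK : LocallyIntegrable K volume) (a b : ℝ) :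
    IntervalIntegrable K volume a b :=
  (hK.integrableOn_isCompact isCompact_uIcc).intervalIntegrable

theorem intervalIntegrable_mul_expI (hK : LocallyIntegrable K volume) (ω a b : ℝ) :
    IntervalIntegrable (fun t => (K t : ℂ) * expI ω t) volume a b :=
  IntervalIntegrable.mul_continuousOn
    ⟨(intervalIntegrable_kernel hK a b).1.ofReal, (intervalIntegrable_kernel hK a b).2.ofReal⟩
    (continuous_expI_right ω).continuousOn

theorem norm_integral_mul_expI_le_integral (hK : LocallyIntegrable K volume) (ω : ℝ) {a b : ℝ}
    (hab : a ≤ b) (hpos : ∀ t ∈ Set.Ioc a b, 0 ≤ K t) :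
    ‖∫ t in a..b, (K t : ℂ) * expI ω t‖ ≤ ∫ t in a..b, K t := by
  refine intervalIntegral.norm_integral_le_of_norm_le hab ?_ (intervalIntegrable_kernel hK a b)
  refine Eventually.of_forall fun t ht => ?_
  rw [norm_mul, norm_expI, mul_one, Complex.norm_real, Real.norm_of_nonneg (hpos t ht)]

theorem integral_le_of_antitoneOn (hK : LocallyIntegrable K volume) {A : ℝ}
    (hanti : AntitoneOn K (Set.Ici A)) {a h : ℝ} (ha : A ≤ a) (hh : 0 ≤ h) :
    ∫ t in a..(a + h), K t ≤ h * K a := by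
  have : ∫ t in a..(a + h), K t ≤ ∫ _ in a..(a + h), K a := by
    refine intervalIntegral.integral_mono_on (by linarith) (intervalIntegrable_kernel hK _ _)
      (by simp) fun t ht => ?_
    exact hanti ha (ha.trans ht.1) ht.1
  simpa using this

/-- Decay of oscillatory integrals against a monotone amplitude: averaging the integral with its
translate by half a period turns it into an integral of decrements of `K`, which telescopes. -/
theorem norm_integral_mul_expI_le (hK : LocallyIntegrable K volume) {A : ℝ}
    (hanti : AntitoneOn K (Set.Ici A)) (hpos : ∀ t, A ≤ t → 0 ≤ K t) {ω : ℝ} (hω : ω ≠ 0)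
    {R S : ℝ} (hR : A ≤ R) (hRS : R ≤ S) :
    ‖∫ t in R..S, (K t : ℂ) * expI ω t‖ ≤ 3 * Real.pi / 2 * (K R / |ω|) := by
  set h : ℝ := Real.pi / |ω| with hh
  have hhpos : 0 < h := div_pos Real.pi_pos (abs_pos.2 hω)
  set g : ℝ → ℂ := fun t => (K t : ℂ) * expI ω t with hg
  have gint : ∀ a b, IntervalIntegrable g volume a b := intervalIntegrable_mul_expI hK ω
  have kint := intervalIntegrable_kernel hK
  have kshift : IntervalIntegrable (fun t => K (t + h)) volume R S := by
    simpa using (kint (R + h) (S + h)).comp_add_right h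
  have gshift : IntervalIntegrable (fun t => g (t + h)) volume R S := by
    simpa using (gint (R + h) (S + h)).comp_add_right h
  have key : (2 : ℂ) * ∫ t in R..S, g t =
      (∫ t in R..S, (g t + g (t + h))) + (∫ t in R..(R + h), g t) - ∫ t in S..(S + h), g t := by
    rw [intervalIntegral.integral_add (gint _ _) gshift,
      intervalIntegral.integral_comp_add_right]
    have h1 := intervalIntegral.integral_add_adjacent_intervals (gint R (R + h))
      (gint (R + h) (S + h))
    have h2 := intervalIntegral.integral_add_adjacent_intervals (gint R S) (gint S (S + h))
    linear_combination -h1 + h2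
  have b1 : ‖∫ t in R..S, (g t + g (t + h))‖ ≤ h * K R := by
    have : ‖∫ t in R..S, (g t + g (t + h))‖ ≤ ∫ t in R..S, (K t - K (t + h)) := by
      refine intervalIntegral.norm_integral_le_of_norm_le hRS ?_ ((kint _ _).sub kshift)
      refine Eventually.of_forall fun t ht => ?_
      have e : g t + g (t + h) = ((K t - K (t + h) : ℝ) : ℂ) * expI ω t := by
        simp only [hg, hh, expI_add_half_period hω]; push_cast; ring
      rw [e, norm_mul, norm_expI, mul_one, Complex.norm_real, Real.norm_of_nonneg]
      have : A ≤ t := hR.trans ht.1.le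
      exact sub_nonneg.2 (hanti this (by simp only [Set.mem_Ici]; linarith) (by linarith))
    refine this.trans ?_
    rw [intervalIntegral.integral_sub (kint _ _) kshift, intervalIntegral.integral_comp_add_right]
    have h1 := intervalIntegral.integral_add_adjacent_intervals (kint R (R + h))
      (kint (R + h) (S + h))
    have h2 := intervalIntegral.integral_add_adjacent_intervals (kint R S) (kint S (S + h))
    have h3 := integral_le_of_antitoneOn hK hanti hR hhpos.le
    have h4 : 0 ≤ ∫ t in S..(S + h), K t :=
      intervalIntegral.integral_nonneg (by linarith) fun t ht => hpos t (by linarith [ht.1])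
    linarith
  have b2 : ∀ a, R ≤ a → ‖∫ t in a..(a + h), g t‖ ≤ h * K R := fun a ha => by
    refine (norm_integral_mul_expI_le_integral hK ω (by linarith)
      fun t ht => hpos t (by linarith [ht.1])).trans ?_
    refine (integral_le_of_antitoneOn hK hanti (hR.trans ha) hhpos.le).trans ?_
    exact mul_le_mul_of_nonneg_left (hanti hR (hR.trans ha) ha) hhpos.le
  have : 2 * ‖∫ t in R..S, g t‖ ≤ 3 * (h * K R) := by
    calc 2 * ‖∫ t in R..S, g t‖ = ‖(2 : ℂ) * ∫ t in R..S, g t‖ := by simp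
      _ ≤ h * K R + h * K R + h * K R := by
        rw [key]
        exact (norm_sub_le _ _).trans (add_le_add ((norm_add_le _ _).trans
          (add_le_add b1 (b2 R le_rfl))) (b2 S hRS))
      _ = _ := by ring
  have e : 3 * Real.pi / 2 * (K R / |ω|) = 3 * (h * K R) / 2 := by rw [hh]; ring
  rw [e]; linarith

/-- The data of a kernel with a nonincreasing tail bounded by `C / t` on `[A, ∞)`. -/
structure TailBound (K : ℝ → ℝ) (A C : ℝ) : Prop where
  locInt : LocallyIntegrable K volume
  pos : ∀ t, t ≠ 0 → 0 < K t
  one_le : 1 ≤ A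
  anti : AntitoneOn K (Set.Ici A)
  bound : ∀ t, A ≤ t → K t * t ≤ C

namespace TailBound

variable {A C : ℝ}

theorem A_pos (h : TailBound K A C) : 0 < A := zero_lt_one.trans_le h.one_le

theorem nonneg (h : TailBound K A C) {t : ℝ} (ht : A ≤ t) : 0 ≤ K t :=
  (h.pos t (h.A_pos.trans_le ht).ne').le

theorem C_pos (h : TailBound K A C) : 0 < C :=
  (mul_pos (h.pos A h.A_pos.ne') h.A_pos).trans_le (h.bound A le_rfl)

theorem tendsto_zero (h : TailBound K A C) : Tendsto K atTop (𝓝 0) := by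
  refine squeeze_zero' (g := fun t => C / t) ?_ ?_ (tendsto_const_nhds.div_atTop tendsto_id)
  · filter_upwards [eventually_ge_atTop A] with t ht using h.nonneg ht
  · filter_upwards [eventually_ge_atTop A] with t ht
    rw [le_div_iff₀ (h.A_pos.trans_le ht)]
    exact h.bound t ht

theorem truncFT_sub (h : TailBound K A C) (R S ω : ℝ) :
    truncFT K S ω - truncFT K R ω = ∫ t in R..S, (K t : ℂ) * expI ω t :=
  intervalIntegral.integral_interval_sub_left (intervalIntegrable_mul_expI h.locInt ω _ _)
    (intervalIntegrable_mul_expI h.locInt ω _ _)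

theorem norm_truncFT_sub_le (h : TailBound K A C) {ω : ℝ} (hω : ω ≠ 0) {R S : ℝ} (hR : A ≤ R)
    (hRS : R ≤ S) : ‖truncFT K S ω - truncFT K R ω‖ ≤ 3 * Real.pi / 2 * (K R / |ω|) := by
  rw [h.truncFT_sub]
  exact norm_integral_mul_expI_le h.locInt h.anti (fun t ht => h.nonneg ht) hω hR hRS

theorem tendsto_truncFT (h : TailBound K A C) {ω : ℝ} (hω : ω ≠ 0) :
    Tendsto (fun R => truncFT K R ω) atTop (𝓝 (halfFT K ω)) := by
  refine CauchySeq.tendsto_limUnder (Metric.cauchySeq_iff'.2 fun ε hε => ?_)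
  have hlim : Tendsto (fun R => 3 * Real.pi / 2 * (K R / |ω|)) atTop (𝓝 0) := by
    simpa using (h.tendsto_zero.div_const |ω|).const_mul (3 * Real.pi / 2)
  obtain ⟨N, hN, hNA⟩ := ((hlim.eventually (gt_mem_nhds hε)).and (eventually_ge_atTop A)).exists
  refine ⟨N, fun S hS => ?_⟩
  rw [dist_eq_norm]
  exact (h.norm_truncFT_sub_le hω hNA hS).trans_lt hN

theorem norm_halfFT_sub_truncFT_le (h : TailBound K A C) {ω : ℝ} (hω : ω ≠ 0) {R : ℝ}
    (hR : A ≤ R) : ‖halfFT K ω - truncFT K R ω‖ ≤ 3 * Real.pi / 2 * (K R / |ω|) := by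
  refine le_of_tendsto ((h.tendsto_truncFT hω).sub_const _).norm ?_
  filter_upwards [eventually_ge_atTop R] with S hS using h.norm_truncFT_sub_le hω hR hS

theorem continuous_truncFT (h : TailBound K A C) (R : ℝ) : Continuous (truncFT K R) := by
  refine intervalIntegral.continuous_of_dominated_interval (bound := fun t => ‖K t‖)
    (fun ω => ?_) (fun ω => Eventually.of_forall fun t _ => ?_)
    (intervalIntegrable_kernel h.locInt _ _).norm (Eventually.of_forall fun t _ => ?_)
  · exact (intervalIntegrable_mul_expI h.locInt ω 0 R).def'.aestronglyMeasurable
  · simp [norm_expI]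
  · fun_prop

theorem continuousAt_halfFT (h : TailBound K A C) {ω : ℝ} (hω : ω ≠ 0) :
    ContinuousAt (halfFT K) ω := by
  set δ : ℝ := |ω| / 2
  have hδ : 0 < δ := half_pos (abs_pos.2 hω)
  have hopen : IsOpen {x : ℝ | δ < |x|} := isOpen_lt continuous_const continuous_abs
  have hmem : ω ∈ {x : ℝ | δ < |x|} := half_lt_self (abs_pos.2 hω)
  have hu : TendstoUniformlyOn (fun R => truncFT K R) (halfFT K) atTop {x : ℝ | δ < |x|} := by
    rw [Metric.tendstoUniformlyOn_iff]
    intro ε hε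
    have hlim : Tendsto (fun R => 3 * Real.pi / 2 * (K R / δ)) atTop (𝓝 0) := by
      simpa using (h.tendsto_zero.div_const δ).const_mul (3 * Real.pi / 2)
    filter_upwards [hlim.eventually (gt_mem_nhds hε), eventually_ge_atTop A] with R hRε hRA x hx
    have hx : δ < |x| := hx
    have hx0 : x ≠ 0 := abs_pos.1 (hδ.trans hx)
    rw [dist_eq_norm]
    refine (h.norm_halfFT_sub_truncFT_le hx0 hRA).trans_lt (lt_of_le_of_lt ?_ hRε)
    have := h.nonneg hRA
    gcongr
  exact (hu.continuousOn (Frequently.of_forall fun R =>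
    (h.continuous_truncFT R).continuousOn)).continuousAt (hopen.mem_nhds hmem)

theorem measurable_halfFT (h : TailBound K A C) : Measurable (halfFT K) := by
  have hc : ContinuousOn (halfFT K) {0}ᶜ := fun x hx =>
    (h.continuousAt_halfFT hx).continuousWithinAt
  exact measurable_of_continuousOn_compl_singleton 0 hc

theorem truncFT_neg (R ω : ℝ) : truncFT K R (-ω) = conj (truncFT K R ω) := by
  unfold truncFT
  rw [← intervalIntegral.intervalIntegral_conj]
  simp [expI_neg_left]

theorem halfFT_neg (h : TailBound K A C) {ω : ℝ} (hω : ω ≠ 0) :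
    halfFT K (-ω) = conj (halfFT K ω) := by
  refine tendsto_nhds_unique (h.tendsto_truncFT (neg_ne_zero.2 hω)) ?_
  simp_rw [truncFT_neg]
  exact (Complex.continuous_conj.tendsto _).comp (h.tendsto_truncFT hω)

theorem truncFT_re (h : TailBound K A C) (R ω : ℝ) :
    (truncFT K R ω).re = ∫ t in (0 : ℝ)..R, K t * Real.cos (ω * t) := by
  have e := Complex.reCLM.intervalIntegral_comp_comm (intervalIntegrable_mul_expI h.locInt ω 0 R)
  rw [truncFT]
  refine e.symm.trans (intervalIntegral.integral_congr fun t _ => ?_)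
  simp [expI_re]

/-! ### Size of the half-line transform -/

/-- Below the frequency `1 / T` the truncated transform does not oscillate. -/
theorem norm_truncFT_sub_integral_le (h : TailBound K A C) {T ω : ℝ} (hT : A ≤ T)
    (hω : |ω| * T = 1) :
    ‖truncFT K T ω - ((∫ t in (0 : ℝ)..T, K t : ℝ) : ℂ)‖ ≤ (∫ t in (0 : ℝ)..A, K t) + C := by
  have hT0 : 0 < T := h.A_pos.trans_le hT
  have kint := intervalIntegrable_kernel h.locInt
  have kxint : ∀ a b, IntervalIntegrable (fun t => K t * (|ω| * t)) volume a b := fun a b =>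
    (kint a b).mul_continuousOn (by fun_prop)
  have e : truncFT K T ω - ((∫ t in (0 : ℝ)..T, K t : ℝ) : ℂ) =
      ∫ t in (0 : ℝ)..T, (K t : ℂ) * (expI ω t - 1) := by
    have kcint : IntervalIntegrable (fun t => (K t : ℂ)) volume 0 T :=
      ⟨(kint 0 T).1.ofReal, (kint 0 T).2.ofReal⟩
    simp only [mul_sub, mul_one]
    rw [intervalIntegral.integral_sub (intervalIntegrable_mul_expI h.locInt ω _ _) kcint,
      ← intervalIntegral.integral_ofReal, truncFT]
  have b : ‖∫ t in (0 : ℝ)..T, (K t : ℂ) * (expI ω t - 1)‖ ≤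
      ∫ t in (0 : ℝ)..T, K t * (|ω| * t) := by
    refine intervalIntegral.norm_integral_le_of_norm_le hT0.le ?_ (kxint _ _)
    refine Eventually.of_forall fun t ht => ?_
    have hk := (h.pos t ht.1.ne').le
    rw [norm_mul, Complex.norm_real, Real.norm_of_nonneg hk]
    refine mul_le_mul_of_nonneg_left ((norm_expI_sub_one_le ω t).trans ?_) hk
    rw [abs_mul, abs_of_pos ht.1]
  rw [e]
  refine b.trans ?_
  rw [← intervalIntegral.integral_add_adjacent_intervals (kxint 0 A) (kxint A T)]
  refine add_le_add ?_ ?_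
  · refine intervalIntegral.integral_mono_on_of_le_Ioo h.A_pos.le (kxint _ _) (kint _ _)
      fun t ht => ?_
    have hk := (h.pos t ht.1.ne').le
    refine mul_le_of_le_one_right hk ?_
    rw [← hω]
    exact mul_le_mul_of_nonneg_left (ht.2.le.trans hT) (abs_nonneg _)
  · have : ∫ t in A..T, K t * (|ω| * t) ≤ ∫ _ in A..T, C * |ω| := by
      refine intervalIntegral.integral_mono_on hT (kxint _ _) (by simp) fun t ht => ?_
      have := mul_le_mul_of_nonneg_right (h.bound t ht.1) (abs_nonneg ω)
      linarith
    refine this.trans ?_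
    simp only [intervalIntegral.integral_const, smul_eq_mul]
    have := h.C_pos
    have h1 : (T - A) * (C * |ω|) = C * (|ω| * T) - A * C * |ω| := by ring
    rw [h1, hω]
    have := mul_nonneg (mul_nonneg h.A_pos.le h.C_pos.le) (abs_nonneg ω)
    linarith

/-- At low frequency the transform is the primitive of `K` at `1 / |ω|`, up to a bounded error. -/
theorem norm_halfFT_sub_integral_le (h : TailBound K A C) {T ω : ℝ} (hT : A ≤ T)
    (hω : |ω| * T = 1) :
    ‖halfFT K ω - ((∫ t in (0 : ℝ)..T, K t : ℝ) : ℂ)‖ ≤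
      (∫ t in (0 : ℝ)..A, K t) + C + 3 * Real.pi / 2 * C := by
  have hω0 : ω ≠ 0 := by rintro rfl; simp at hω
  have h1 := h.norm_halfFT_sub_truncFT_le hω0 hT
  have h2 := h.norm_truncFT_sub_integral_le hT hω
  have h3 : K T / |ω| = K T * T := by
    rw [div_eq_iff (abs_pos.2 hω0).ne', mul_assoc, mul_comm T, hω, mul_one]
  rw [h3] at h1
  have h4 : 3 * Real.pi / 2 * (K T * T) ≤ 3 * Real.pi / 2 * C :=
    mul_le_mul_of_nonneg_left (h.bound T hT) (by positivity)
  have := norm_add_le (halfFT K ω - truncFT K T ω)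
    (truncFT K T ω - ((∫ t in (0 : ℝ)..T, K t : ℝ) : ℂ))
  rw [sub_add_sub_cancel] at this
  linarith

/-- A crude substitute for the logarithmic growth of the primitive of `K`, which yields bounds by
the locally integrable function `|ω|^(-1/2)`. -/
theorem integral_zero_le (h : TailBound K A C) {T : ℝ} (hT : A ≤ T) :
    ∫ t in (0 : ℝ)..T, K t ≤ (∫ t in (0 : ℝ)..A, K t) + 2 * C * √T := by
  have kint := intervalIntegrable_kernel h.locInt
  have hA := h.A_pos
  rw [← intervalIntegral.integral_add_adjacent_intervals (kint 0 A) (kint A T)]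
  gcongr
  have i1 : ∫ t in A..T, K t ≤ ∫ t in A..T, C * t ^ (-(1 / 2) : ℝ) := by
    refine intervalIntegral.integral_mono_on hT (kint _ _) ?_ fun t ht => ?_
    · refine (intervalIntegral.intervalIntegrable_rpow' (by norm_num)).const_mul _
    · have ht1 : 1 ≤ t := h.one_le.trans ht.1
      have ht0 : 0 < t := by linarith
      calc K t ≤ C * t ^ (-1 : ℝ) := by
            rw [Real.rpow_neg_one, ← div_eq_mul_inv, le_div_iff₀ ht0]; exact h.bound t ht.1
        _ ≤ _ := mul_le_mul_of_nonneg_left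
            (Real.rpow_le_rpow_of_exponent_le ht1 (by norm_num)) h.C_pos.le
  refine i1.trans ?_
  rw [intervalIntegral.integral_const_mul, integral_rpow (Or.inl (by norm_num))]
  have e : (-(1 / 2) + 1 : ℝ) = 1 / 2 := by norm_num
  rw [e, ← Real.sqrt_eq_rpow, ← Real.sqrt_eq_rpow]
  have := mul_nonneg h.C_pos.le (Real.sqrt_nonneg A)
  linarith

/-- A bound on the truncated transforms, uniform in the truncation and locally integrable in the
frequency. -/
theorem norm_truncFT_le (h : TailBound K A C) {ω : ℝ} (hω : ω ≠ 0) {R : ℝ} (hR : A ≤ R) :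
    ‖truncFT K R ω‖ ≤ ((∫ t in (0 : ℝ)..A, K t) + 2 * C * √A + 3 * Real.pi / 2 * C) +
      2 * C * |ω| ^ (-(1 / 2) : ℝ) := by
  have hC := h.C_pos
  have hω' := abs_pos.2 hω
  have sq : ∀ T, T ≤ max A |ω|⁻¹ → √T ≤ √A + |ω| ^ (-(1 / 2) : ℝ) := fun T hT => by
    have e : √(|ω|⁻¹) = |ω| ^ (-(1 / 2) : ℝ) := by
      rw [Real.sqrt_eq_rpow, Real.inv_rpow hω'.le, Real.rpow_neg hω'.le]
    rw [← e]
    refine (Real.sqrt_le_sqrt hT).trans ?_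
    rcases max_cases A |ω|⁻¹ with ⟨h1, _⟩ | ⟨h1, _⟩ <;> rw [h1]
    · linarith [Real.sqrt_nonneg |ω|⁻¹]
    · linarith [Real.sqrt_nonneg A]
  -- before time `max A (1 / |ω|)` the integral of `K` is a good enough bound
  have small : ∀ T, A ≤ T → T ≤ max A |ω|⁻¹ → ‖truncFT K T ω‖ ≤
      (∫ t in (0 : ℝ)..A, K t) + 2 * C * (√A + |ω| ^ (-(1 / 2) : ℝ)) := fun T hAT hT => by
    refine (norm_integral_mul_expI_le_integral h.locInt ω (h.A_pos.le.trans hAT)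
      fun t ht => (h.pos t ht.1.ne').le).trans ((h.integral_zero_le hAT).trans ?_)
    have := sq T hT
    gcongr
  have hpi : 0 ≤ 3 * Real.pi / 2 * C := by positivity
  rcases le_total R (max A |ω|⁻¹) with hle | hle
  · linarith [small R hR hle]
  -- afterwards the oscillation contributes at most a multiple of `K(T) / |ω| ≤ K(T) T ≤ C`
  · have h1 := small _ (le_max_left _ _) le_rfl
    have h2 := h.norm_truncFT_sub_le hω (le_max_left _ _) hle
    have h3 : K (max A |ω|⁻¹) / |ω| ≤ C := by
      refine le_trans ?_ (h.bound _ (le_max_left A |ω|⁻¹))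
      rw [div_eq_mul_inv]
      exact mul_le_mul_of_nonneg_left (le_max_right _ _) (h.nonneg (le_max_left _ _))
    have h4 : 3 * Real.pi / 2 * (K (max A |ω|⁻¹) / |ω|) ≤ 3 * Real.pi / 2 * C :=
      mul_le_mul_of_nonneg_left h3 (by positivity)
    have := norm_add_le (truncFT K R ω - truncFT K (max A |ω|⁻¹) ω) (truncFT K (max A |ω|⁻¹) ω)
    rw [sub_add_cancel] at this
    linarith

end TailBound

/-! ### Memory kernels with tail `c / t` -/

/-- A memory kernel with tail `c / t` satisfies the quantitative tail bounds. -/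
theorem IsMemoryKernel.exists_tailBound (hK : IsMemoryKernel K) {c : ℝ}
    (hc : Tendsto (fun t => K t / t⁻¹) atTop (𝓝 c)) : ∃ A C, TailBound K A C := by
  obtain ⟨A, hA⟩ := hK.eventually_decreasing
  obtain ⟨B, hB⟩ := eventually_atTop.1 (hc.eventually (ge_mem_nhds (lt_add_one c)))
  refine ⟨max A (max B 1), c + 1, hK.locallyIntegrable, hK.pos,
    (le_max_right _ _).trans (le_max_right _ _),
    hA.mono (Set.Ici_subset_Ici.2 (le_max_left _ _)), fun t ht => ?_⟩
  simpa using hB t ((le_max_left _ _).trans ((le_max_right _ _).trans ht))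

theorem IsMemoryKernel.halfFT_re_pos (hK : IsMemoryKernel K) {A C : ℝ} (h : TailBound K A C)
    {ω : ℝ} (hω : ω ≠ 0) : 0 < (halfFT K ω).re := by
  obtain ⟨L, hL, hlim⟩ := hK.cos_transform_pos ω hω
  have := (Complex.continuous_re.tendsto _).comp (h.tendsto_truncFT hω)
  simp only [Function.comp_def, h.truncFT_re] at this
  rwa [tendsto_nhds_unique this hlim]

/-- The primitive of a kernel with tail `c / t` grows like `c log T`. -/
theorem tendsto_integral_div_log (hK : LocallyIntegrable K volume) {c : ℝ}
    (hc : Tendsto (fun t => K t / t⁻¹) atTop (𝓝 c)) :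
    Tendsto (fun T => (∫ t in (0 : ℝ)..T, K t) / Real.log T) atTop (𝓝 c) := by
  have kint := intervalIntegrable_kernel hK
  rw [Metric.tendsto_atTop']
  intro ε hε
  obtain ⟨B, hB⟩ := eventually_atTop.1
    ((Metric.tendsto_nhds.1 hc (ε / 2) (half_pos hε)).and (eventually_ge_atTop 1))
  have hB1 : 1 ≤ B := (hB B le_rfl).2
  have hB0 : 0 < B := by linarith
  set M : ℝ := |(∫ t in (0 : ℝ)..B, K t) - c * Real.log B|
  have hlog : Tendsto (fun T => M / Real.log T) atTop (𝓝 0) :=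
    tendsto_const_nhds.div_atTop Real.tendsto_log_atTop
  obtain ⟨N, hN⟩ := eventually_atTop.1 ((hlog.eventually (gt_mem_nhds (half_pos hε))).and
    ((eventually_ge_atTop B).and (eventually_gt_atTop 1)))
  refine ⟨N, fun T hT => ?_⟩
  obtain ⟨h1, h2, h3⟩ := hN T hT.le
  have hl : 0 < Real.log T := Real.log_pos h3
  have hlB : 0 ≤ Real.log B := Real.log_nonneg hB1
  have iinv : IntervalIntegrable (fun t : ℝ => t⁻¹) volume B T := by
    refine ContinuousOn.intervalIntegrable (ContinuousOn.inv₀ continuousOn_id fun t ht => ?_)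
    rw [Set.uIcc_of_le h2] at ht
    exact (hB0.trans_le ht.1).ne'
  have e1 : (∫ t in B..T, t⁻¹) = Real.log T - Real.log B := by
    rw [integral_inv_of_pos hB0 (by linarith), Real.log_div (by linarith) hB0.ne']
  have b1 : |(∫ t in B..T, K t) - c * (Real.log T - Real.log B)| ≤
      ε / 2 * (Real.log T - Real.log B) := by
    rw [← e1, ← intervalIntegral.integral_const_mul, ← intervalIntegral.integral_const_mul,
      ← intervalIntegral.integral_sub (kint _ _) (iinv.const_mul c), ← Real.norm_eq_abs]
    refine intervalIntegral.norm_integral_le_of_norm_le h2 (Eventually.of_forall fun t ht => ?_)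
      (iinv.const_mul _)
    have ht0 : 0 < t := hB0.trans ht.1
    have := (hB t ht.1.le).1
    rw [Real.dist_eq] at this
    have e : K t - c * t⁻¹ = (K t / t⁻¹ - c) * t⁻¹ := by field_simp
    rw [e, norm_mul, Real.norm_eq_abs, Real.norm_of_nonneg (inv_pos.2 ht0).le]
    exact mul_le_mul_of_nonneg_right this.le (inv_pos.2 ht0).le
  rw [Real.dist_eq]
  have e2 : (∫ t in (0 : ℝ)..T, K t) / Real.log T - c =
      (((∫ t in (0 : ℝ)..B, K t) - c * Real.log B) +
        ((∫ t in B..T, K t) - c * (Real.log T - Real.log B))) / Real.log T := by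
    rw [← intervalIntegral.integral_add_adjacent_intervals (kint 0 B) (kint B T)]
    field_simp
    ring
  rw [e2, abs_div, abs_of_pos hl, div_lt_iff₀ hl]
  rw [div_lt_iff₀ hl] at h1
  have := abs_add_le ((∫ t in (0 : ℝ)..B, K t) - c * Real.log B)
    ((∫ t in B..T, K t) - c * (Real.log T - Real.log B))
  have h5 : 0 ≤ ε / 2 * Real.log B := mul_nonneg (half_pos hε).le hlB
  have h6 : |(∫ t in (0 : ℝ)..B, K t) - c * Real.log B| = M := rfl
  linarith

/-! ### Fourier calculus on Schwartz functions -/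

theorem expI_comm (ω t : ℝ) : expI ω t = expI t ω := by
  rw [expI, expI]; congr 1; ring

theorem ft_eq_integral_expI (φ : 𝓢(ℝ, ℂ)) (ω : ℝ) : ft φ ω = ∫ t, expI ω t * φ t :=
  ft_apply φ ω

theorem integrable_expI_mul {f : ℝ → ℂ} (hf : Integrable f) (ω : ℝ) :
    Integrable fun t => expI ω t * f t :=
  hf.bdd_mul (c := 1) (continuous_expI_right ω).aestronglyMeasurable
    (Eventually.of_forall fun t => (norm_expI ω t).le)

/-- Symmetry of the Fourier pairing for integrable functions. -/
theorem integral_fourier_mul_eq {χ f : ℝ → ℂ} (hχ : Integrable χ) (hf : Integrable f) :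
    ∫ t, (∫ ω, expI t ω * χ ω) * f t = ∫ ω, χ ω * ∫ t, expI ω t * f t := by
  have hint : Integrable (fun p : ℝ × ℝ => expI p.1 p.2 * (f p.1 * χ p.2))
      (volume.prod volume) :=
    (hf.mul_prod hχ).bdd_mul (c := 1) continuous_expI.aestronglyMeasurable
      (Eventually.of_forall fun p => (norm_expI _ _).le)
  calc ∫ t, (∫ ω, expI t ω * χ ω) * f t
      = ∫ t, ∫ ω, expI t ω * (f t * χ ω) := by
        congr 1; ext t
        rw [← integral_mul_const]
        congr 1; ext ω; ring
    _ = ∫ ω, ∫ t, expI t ω * (f t * χ ω) := integral_integral_swap hint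
    _ = _ := by
        congr 1; ext ω
        rw [← integral_const_mul]
        congr 1; ext t; rw [expI_comm t ω]; ring

theorem integral_ft_mul_eq (χ : 𝓢(ℝ, ℂ)) {f : ℝ → ℂ} (hf : Integrable f) :
    ∫ t, ft χ t * f t = ∫ ω, χ ω * ∫ t, expI ω t * f t := by
  simp_rw [ft_eq_integral_expI]
  exact integral_fourier_mul_eq χ.integrable hf

/-- The pointwise product of two Schwartz functions. -/
noncomputable def schwartzMul (f g : 𝓢(ℝ, ℂ)) : 𝓢(ℝ, ℂ) :=
  SchwartzMap.pairing (ContinuousLinearMap.mul ℂ ℂ) f g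

@[simp]
theorem schwartzMul_apply (f g : 𝓢(ℝ, ℂ)) (x : ℝ) : schwartzMul f g x = f x * g x := rfl

/-- Reflection on Schwartz functions. -/
noncomputable def reflectCLM : 𝓢(ℝ, ℂ) →L[ℂ] 𝓢(ℝ, ℂ) :=
  SchwartzMap.compCLMOfContinuousLinearEquiv ℂ (ContinuousLinearEquiv.neg ℝ)

@[simp]
theorem reflectCLM_apply (f : 𝓢(ℝ, ℂ)) (x : ℝ) : reflectCLM f x = f (-x) := rfl

theorem coe_reflectCLM (f : 𝓢(ℝ, ℂ)) : (reflectCLM f : ℝ → ℂ) = reflect f := rfl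

theorem ft_reflectCLM (φ : 𝓢(ℝ, ℂ)) : ft (reflectCLM φ) = reflectCLM (ft φ) := by
  ext ω
  rw [reflectCLM_apply, ft_eq_integral_expI, ft_eq_integral_expI, ← integral_neg_eq_self]
  simp [expI_neg_right]

theorem ft_ft (φ : 𝓢(ℝ, ℂ)) : ft (ft φ) = (2 * Real.pi : ℂ) • reflectCLM φ := by
  ext ω
  have hpi := Real.pi_pos
  have h1 : ∀ x, ft φ x = (𝓕 φ) (freqScale x) := fun x => rfl
  have hs : ∀ x, freqScale x = -(2 * Real.pi)⁻¹ * x := fun x => by simp [freqScale, mul_comm]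
  rw [ft_eq_integral_expI]
  have h2 : ∀ t, expI ω t * ft φ t = (fun s => expI (-(2 * Real.pi) * ω) s * (𝓕 φ) s)
      (-(2 * Real.pi)⁻¹ * t) := fun t => by
    simp only [h1, hs]
    congr 1
    simp only [expI]
    congr 1
    have : (Real.pi : ℂ) ≠ 0 := by exact_mod_cast Real.pi_ne_zero
    push_cast; field_simp
  rw [integral_congr_ae (Eventually.of_forall h2),
    Measure.integral_comp_mul_left
      (fun s => expI (-(2 * Real.pi) * ω) s * (𝓕 φ : 𝓢(ℝ, ℂ)) s)]
  have h3 : ∫ s, expI (-(2 * Real.pi) * ω) s * (𝓕 φ) s = φ (-ω) := by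
    have h4 : (𝓕⁻ (𝓕 φ)) (-ω) = φ (-ω) := by rw [FourierTransform.fourierInv_fourier_eq]
    rw [← h4, SchwartzMap.fourierInv_coe, Real.fourierInv_eq']
    congr 1; ext s
    rw [smul_eq_mul, expI]
    congr 2
    simp
    ring
  rw [h3]
  simp [abs_of_pos hpi]

/-- The inverse of `ft` on Schwartz functions. -/
noncomputable def ftInv (a : 𝓢(ℝ, ℂ)) : 𝓢(ℝ, ℂ) := (2 * Real.pi : ℂ)⁻¹ • ft (reflectCLM a)

theorem ft_ftInv (a : 𝓢(ℝ, ℂ)) : ft (ftInv a) = a := by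
  have hpi : (2 * Real.pi : ℂ) ≠ 0 := by simp [Real.pi_ne_zero]
  rw [ftInv, map_smul, ft_ft, smul_smul, inv_mul_cancel₀ hpi, one_smul]
  ext x
  simp

theorem conj_ftInv {b : 𝓢(ℝ, ℂ)} (hb : ∀ x, conj (b x) = b x) (x : ℝ) :
    conj (ftInv b x) = ftInv b (-x) := by
  have hc : conj ((2 * Real.pi : ℂ)⁻¹) = (2 * Real.pi : ℂ)⁻¹ := by
    rw [show (2 * Real.pi : ℂ)⁻¹ = (((2 * Real.pi)⁻¹ : ℝ) : ℂ) by push_cast; rfl,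
      Complex.conj_ofReal]
  simp only [ftInv, smul_apply, smul_eq_mul, map_mul, ft_eq_integral_expI,
    ← integral_conj, reflectCLM_apply, hb, expI_neg_left, hc]

theorem integral_ft_mul_translate (χ φ : 𝓢(ℝ, ℂ)) (u : ℝ) :
    ∫ t, ft χ t * φ (t - u) = ft (schwartzMul χ (ft φ)) u := by
  rw [integral_ft_mul_eq χ (φ.integrable.comp_sub_right u), ft_eq_integral_expI]
  congr 1; ext ω
  have : ∫ t, expI ω t * φ (t - u) = expI ω u * ft φ ω := by
    rw [← integral_add_right_eq_self _ u, ft_eq_integral_expI, ← integral_const_mul]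
    congr 1; ext t
    rw [add_sub_cancel_right, expI_add]; ring
  rw [this, schwartzMul_apply, expI_comm ω u]; ring

theorem ft_deriv (φ : 𝓢(ℝ, ℂ)) (ω : ℝ) :
    ft (SchwartzMap.derivCLM ℂ ℂ φ) ω = -(Complex.I * ω) * ft φ ω := by
  rw [ft_eq_integral_expI, ft_eq_integral_expI]
  have hd : ∀ t, HasDerivAt (expI ω) (Complex.I * ω * expI ω t) t := fun t => by
    have h1 : HasDerivAt (fun s : ℝ => Complex.I * (s : ℂ) * ω) (Complex.I * ω) t := by
      simpa using ((Complex.ofRealCLM.hasDerivAt (x := t)).const_mul Complex.I).mul_const (ω : ℂ)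
    have := h1.cexp
    rwa [mul_comm] at this
  have := integral_mul_deriv_eq_deriv_mul_of_integrable (u := expI ω) (v := φ)
    (fun t _ => hd t) (fun t _ => φ.hasDerivAt t)
    (integrable_expI_mul (SchwartzMap.derivCLM ℂ ℂ φ).integrable ω)
    (by
      have := (integrable_expI_mul φ.integrable ω).const_mul (Complex.I * ω)
      refine this.congr (Eventually.of_forall fun t => ?_)
      simp only [Pi.mul_apply]; ring) (integrable_expI_mul φ.integrable ω)
  simp only [SchwartzMap.derivCLM_apply]
  rw [this, ← integral_const_mul, ← integral_neg]
  congr 1; ext t; ring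

theorem norm_schwartz_le (f : 𝓢(ℝ, ℂ)) : ∃ B, 0 ≤ B ∧ ∀ x, ‖f x‖ ≤ B := by
  obtain ⟨B, hB, h⟩ := f.decay 0 0
  exact ⟨B, hB.le, fun x => by simpa using h x⟩

/-! ### The Fourier transform of the one-sided kernel -/

variable {A C : ℝ}

theorem locallyIntegrable_abs_rpow {r : ℝ} (hr : -1 < r) :
    LocallyIntegrable (fun x : ℝ => |x| ^ r) volume := by
  have h0 : ∀ b, 0 ≤ b → IntervalIntegrable (fun x : ℝ => |x| ^ r) volume 0 b := fun b hb => by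
    refine (intervalIntegral.intervalIntegrable_rpow' hr).congr fun x hx => ?_
    rw [Set.uIoc_of_le hb] at hx
    simp only [abs_of_pos hx.1]
  have h1 : ∀ b, 0 ≤ b → IntervalIntegrable (fun x : ℝ => |x| ^ r) volume (-b) b := fun b hb => by
    refine IntervalIntegrable.trans (b := 0) ?_ (h0 b hb)
    simpa using ((h0 b hb).comp_sub_left 0).symm
  intro x
  refine ⟨Set.Ioc (-(|x| + 1)) (|x| + 1), ?_, (h1 _ (by positivity)).1⟩
  refine Ioc_mem_nhds ?_ ?_
  · linarith [neg_abs_le x]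
  · linarith [le_abs_self x]

theorem integrable_schwartz_mul_abs_rpow (θ : 𝓢(ℝ, ℂ)) :
    Integrable fun ω => ‖θ ω‖ * |ω| ^ (-(1 / 2) : ℝ) := by
  obtain ⟨B, hB, hθ⟩ := norm_schwartz_le θ
  have hl := locallyIntegrable_abs_rpow (r := -(1 / 2)) (by norm_num)
  have hi : Integrable ((Set.Icc (-1 : ℝ) 1).indicator fun ω : ℝ => |ω| ^ (-(1 / 2) : ℝ)) :=
    (integrable_indicator_iff measurableSet_Icc).2 (hl.integrableOn_isCompact isCompact_Icc)
  refine ((hi.const_mul B).add θ.integrable.norm).mono'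
    (θ.continuous.norm.aestronglyMeasurable.mul hl.aestronglyMeasurable)
    (Eventually.of_forall fun ω => ?_)
  have hr : 0 ≤ |ω| ^ (-(1 / 2) : ℝ) := by positivity
  rw [Real.norm_of_nonneg (by positivity), Pi.add_apply]
  by_cases h : ω ∈ Set.Icc (-1 : ℝ) 1
  · rw [Set.indicator_of_mem h]
    have := mul_le_mul_of_nonneg_right (hθ ω) hr
    linarith [norm_nonneg (θ ω)]
  · rw [Set.indicator_of_notMem h, mul_zero, zero_add]
    refine mul_le_of_le_one_right (norm_nonneg _) ?_
    have : 1 ≤ |ω| := by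
      by_contra hlt
      exact h (abs_le.1 (not_le.1 hlt).le)
    exact Real.rpow_le_one_of_one_le_of_nonpos this (by norm_num)

/-- A kernel with integrable tail bounds times a bounded integrable function is integrable. -/
theorem TailBound.integrableOn_mul (h : TailBound K A C) {G : ℝ → ℂ} (hG : Integrable G) {B : ℝ}
    (hB : ∀ x, ‖G x‖ ≤ B) : IntegrableOn (fun u => (K u : ℂ) * G u) (Set.Ioi 0) := by
  have hA := h.A_pos
  rw [← Set.Ioc_union_Ioi_eq_Ioi hA.le]
  refine IntegrableOn.union ?_ ?_
  · have : IntegrableOn (fun u => (K u : ℂ)) (Set.Ioc 0 A) :=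
      (intervalIntegrable_kernel h.locInt 0 A).1.ofReal
    exact Integrable.mul_bdd this (c := B) hG.aestronglyMeasurable.restrict
      (Eventually.of_forall hB)
  · have hm : AEStronglyMeasurable (fun u => (K u : ℂ)) volume :=
      Complex.continuous_ofReal.comp_aestronglyMeasurable h.locInt.aestronglyMeasurable
    refine Integrable.bdd_mul hG.integrableOn (c := K A) hm.restrict ?_
    refine (ae_restrict_iff' measurableSet_Ioi).2 (Eventually.of_forall fun u hu => ?_)
    have hu : A < u := hu
    rw [Complex.norm_real, Real.norm_of_nonneg (h.nonneg hu.le)]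
    exact h.anti (Set.mem_Ici.2 le_rfl) (Set.mem_Ici.2 hu.le) hu.le

theorem TailBound.integrableOn_mul_schwartz (h : TailBound K A C) (G : 𝓢(ℝ, ℂ)) :
    IntegrableOn (fun u => (K u : ℂ) * G u) (Set.Ioi 0) := by
  obtain ⟨B, _, hB⟩ := norm_schwartz_le G
  exact h.integrableOn_mul G.integrable hB

/-- The Fourier transform of the one-sided kernel is the function `halfFT K`. -/
theorem TailBound.integral_mul_ft (h : TailBound K A C) (θ : 𝓢(ℝ, ℂ)) :
    ∫ u in Set.Ioi (0 : ℝ), (K u : ℂ) * ft θ u = ∫ ω, θ ω * halfFT K ω := by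
  have l1 : Tendsto (fun R : ℝ => ∫ u in (0 : ℝ)..R, (K u : ℂ) * ft θ u) atTop
      (𝓝 (∫ u in Set.Ioi (0 : ℝ), (K u : ℂ) * ft θ u)) :=
    intervalIntegral_tendsto_integral_Ioi 0 (h.integrableOn_mul_schwartz (ft θ)) tendsto_id
  have e : ∀ R, 0 ≤ R → ∫ u in (0 : ℝ)..R, (K u : ℂ) * ft θ u = ∫ ω, θ ω * truncFT K R ω := by
    intro R hR
    have hi : Integrable ((Set.Ioc 0 R).indicator fun u => (K u : ℂ)) :=
      (integrable_indicator_iff measurableSet_Ioc).2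
        (intervalIntegrable_kernel h.locInt 0 R).1.ofReal
    have := integral_ft_mul_eq θ hi
    rw [intervalIntegral.integral_of_le hR, ← integral_indicator measurableSet_Ioc]
    calc _ = ∫ t, ft θ t * (Set.Ioc 0 R).indicator (fun u => (K u : ℂ)) t := by
          congr 1; ext t
          by_cases ht : t ∈ Set.Ioc 0 R <;> simp [ht, mul_comm]
      _ = _ := this
      _ = _ := by
          congr 1; ext ω
          congr 1
          rw [truncFT, intervalIntegral.integral_of_le hR, ← integral_indicator measurableSet_Ioc]
          congr 1; ext t
          by_cases ht : t ∈ Set.Ioc 0 R <;> simp [ht, mul_comm]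
  have l2 : Tendsto (fun R : ℝ => ∫ ω, θ ω * truncFT K R ω) atTop
      (𝓝 (∫ ω, θ ω * halfFT K ω)) := by
    set c₁ := (∫ t in (0 : ℝ)..A, K t) + 2 * C * √A + 3 * Real.pi / 2 * C
    refine tendsto_integral_filter_of_dominated_convergence
      (fun ω => c₁ * ‖θ ω‖ + 2 * C * (‖θ ω‖ * |ω| ^ (-(1 / 2) : ℝ))) ?_ ?_ ?_ ?_
    · exact Eventually.of_forall fun R =>
        (θ.continuous.mul (h.continuous_truncFT R)).aestronglyMeasurable
    · filter_upwards [eventually_ge_atTop A] with R hR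
      filter_upwards [Measure.ae_ne volume 0] with ω hω
      rw [norm_mul]
      have := mul_le_mul_of_nonneg_left (h.norm_truncFT_le hω hR) (norm_nonneg (θ ω))
      refine this.trans (le_of_eq ?_)
      ring
    · exact (θ.integrable.norm.const_mul _).add
        ((integrable_schwartz_mul_abs_rpow θ).const_mul _)
    · filter_upwards [Measure.ae_ne volume 0] with ω hω
      exact (h.tendsto_truncFT hω).const_mul _
  refine tendsto_nhds_unique l1 (l2.congr' ?_)
  filter_upwards [eventually_ge_atTop 0] with R hR using (e R hR).symm

theorem TailBound.norm_halfFT_le (h : TailBound K A C) {ω : ℝ} (hω : ω ≠ 0) :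
    ‖halfFT K ω‖ ≤ ((∫ t in (0 : ℝ)..A, K t) + 2 * C * √A + 3 * Real.pi / 2 * C) +
      2 * C * |ω| ^ (-(1 / 2) : ℝ) := by
  refine le_of_tendsto (h.tendsto_truncFT hω).norm ?_
  filter_upwards [eventually_ge_atTop A] with R hR using h.norm_truncFT_le hω hR

theorem TailBound.locallyIntegrable_halfFT (h : TailBound K A C) :
    LocallyIntegrable (halfFT K) volume := by
  have hl := locallyIntegrable_abs_rpow (r := -(1 / 2)) (by norm_num)
  refine ((locallyIntegrable_const ((∫ t in (0 : ℝ)..A, K t) + 2 * C * √A +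
    3 * Real.pi / 2 * C)).add (hl.smul (2 * C))).mono h.measurable_halfFT.aestronglyMeasurable ?_
  filter_upwards [Measure.ae_ne volume 0] with ω hω
  exact (h.norm_halfFT_le hω).trans (le_abs_self _)

theorem TailBound.integrable_schwartz_mul_halfFT (h : TailBound K A C) (θ : 𝓢(ℝ, ℂ)) :
    Integrable fun ω => θ ω * halfFT K ω := by
  refine ((θ.integrable.norm.const_mul ((∫ t in (0 : ℝ)..A, K t) + 2 * C * √A +
    3 * Real.pi / 2 * C)).add ((integrable_schwartz_mul_abs_rpow θ).const_mul (2 * C))).mono'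
    (θ.continuous.aestronglyMeasurable.mul h.measurable_halfFT.aestronglyMeasurable) ?_
  filter_upwards [Measure.ae_ne volume 0] with ω hω
  rw [norm_mul, Pi.add_apply]
  refine (mul_le_mul_of_nonneg_left (h.norm_halfFT_le hω) (norm_nonneg (θ ω))).trans
    (le_of_eq ?_)
  ring

/-- The convolution `K⁺ * φ` has Fourier transform `halfFT K · ft φ`, tested against `χ`. -/
theorem TailBound.integral_ft_mul_convPlus (h : TailBound K A C) (χ φ : 𝓢(ℝ, ℂ)) :
    ∫ t, ft χ t * convPlus K φ t = ∫ ω, χ ω * (halfFT K ω * ft φ ω) := by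
  have hm : AEStronglyMeasurable (fun u => (K u : ℂ)) (volume.restrict (Set.Ioi 0)) :=
    (Complex.continuous_ofReal.comp_aestronglyMeasurable h.locInt.aestronglyMeasurable).restrict
  obtain ⟨B, hB0, hB⟩ := norm_schwartz_le φ
  have hprod : Integrable (fun p : ℝ × ℝ => ‖ft χ p.2‖ * ‖φ (p.2 - p.1)‖)
      (volume.prod volume) := by
    have := (Integrable.convolution_integrand (ContinuousLinearMap.mul ℂ ℂ) (ft χ).integrable
      (reflectCLM φ).integrable (μ := volume) (ν := volume)).norm
    refine this.congr (Eventually.of_forall fun p => ?_)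
    simp
  set H : ℝ → ℂ := fun u => ((∫ t, ‖ft χ t‖ * ‖φ (t - u)‖ : ℝ) : ℂ) with hH
  have hHint : Integrable H := hprod.integral_prod_left.ofReal
  have hHb : ∀ u, ‖H u‖ ≤ ∫ t, ‖ft χ t‖ * B := fun u => by
    rw [hH, Complex.norm_real, Real.norm_of_nonneg (integral_nonneg fun t => by positivity)]
    refine integral_mono_of_nonneg (Eventually.of_forall fun t => by positivity)
      ((ft χ).integrable.norm.mul_const B) (Eventually.of_forall fun t => ?_)
    exact mul_le_mul_of_nonneg_left (hB _) (norm_nonneg _)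
  have hint : Integrable (fun p : ℝ × ℝ => ft χ p.1 * ((K p.2 : ℂ) * φ (p.1 - p.2)))
      (volume.prod (volume.restrict (Set.Ioi 0))) := by
    have hmeas : AEStronglyMeasurable (fun p : ℝ × ℝ => ft χ p.1 * ((K p.2 : ℂ) * φ (p.1 - p.2)))
        (volume.prod (volume.restrict (Set.Ioi 0))) := by
      refine AEStronglyMeasurable.mul ?_ (AEStronglyMeasurable.mul hm.comp_snd ?_)
      · exact ((ft χ).continuous.comp continuous_fst).aestronglyMeasurable
      · exact (φ.continuous.comp (continuous_fst.sub continuous_snd)).aestronglyMeasurable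
    rw [integrable_prod_iff' hmeas]
    refine ⟨Eventually.of_forall fun u => ?_, ?_⟩
    · refine ((ft χ).integrable.mul_bdd (c := ‖(K u : ℂ)‖ * B) ?_
        (Eventually.of_forall fun t => ?_))
      · have := φ.continuous
        exact Continuous.aestronglyMeasurable (f := fun t => (K u : ℂ) * φ (t - u)) (by fun_prop)
      · rw [norm_mul]
        exact mul_le_mul_of_nonneg_left (hB _) (norm_nonneg _)
    · refine (h.integrableOn_mul hHint hHb).norm.congr (Eventually.of_forall fun u => ?_)
      simp only [norm_mul, hH]
      rw [Complex.norm_real (∫ t, _), Real.norm_of_nonneg (integral_nonneg fun t => by positivity),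
        ← integral_const_mul]
      congr 1; ext t; ring
  calc ∫ t, ft χ t * convPlus K φ t
      = ∫ t, ∫ u in Set.Ioi (0 : ℝ), ft χ t * ((K u : ℂ) * φ (t - u)) := by
        congr 1; ext t
        rw [convPlus, integral_Ici_eq_integral_Ioi, integral_const_mul]
    _ = ∫ u in Set.Ioi (0 : ℝ), ∫ t, ft χ t * ((K u : ℂ) * φ (t - u)) :=
        integral_integral_swap hint
    _ = ∫ u in Set.Ioi (0 : ℝ), (K u : ℂ) * ft (schwartzMul χ (ft φ)) u := by
        congr 1; ext u
        rw [← integral_ft_mul_translate, ← integral_const_mul]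
        congr 1; ext t; ring
    _ = ∫ ω, χ ω * (halfFT K ω * ft φ ω) := by
        rw [h.integral_mul_ft]
        congr 1; ext ω
        rw [schwartzMul_apply]; ring

theorem TailBound.ftDist_convPlus_apply (h : TailBound K A C) {φ : 𝓢(ℝ, ℂ)} {T : 𝓢'(ℝ, ℂ)}
    (hT : IsIntegrationAgainst T (convPlus K φ)) (χ : 𝓢(ℝ, ℂ)) :
    ftDist T χ = ∫ ω, χ ω * (halfFT K ω * ft φ ω) := by
  rw [ftDist_apply, (hT _).2, h.integral_ft_mul_convPlus]

theorem TailBound.isFunction_ftDist_convPlus (h : TailBound K A C) {φ : 𝓢(ℝ, ℂ)} {T : 𝓢'(ℝ, ℂ)}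
    (hT : IsIntegrationAgainst T (convPlus K φ)) :
    IsFunction (ftDist T) (fun ω => halfFT K ω * ft φ ω) :=
  ⟨h.locallyIntegrable_halfFT.mul_continuous (ft φ).continuous,
    fun χ _ => h.ftDist_convPlus_apply hT χ⟩

/-! ### Representatives, and growth of the spectral measure -/

/-- The function representing a distribution is unique almost everywhere. -/
theorem IsFunction.ae_eq {T : 𝓢'(ℝ, ℂ)} {f g : ℝ → ℂ} (hf : IsFunction T f)
    (hg : IsFunction T g) : f =ᵐ[volume] g := by
  refine ae_eq_of_integral_contDiff_smul_eq hf.1 hg.1 fun u hu hc => ?_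
  have hc' : HasCompactSupport (fun x => (u x : ℂ)) := hc.comp_left (g := Complex.ofReal) rfl
  have hu' : ContDiff ℝ (⊤ : ℕ∞) (fun x => (u x : ℂ)) := Complex.ofRealCLM.contDiff.comp hu
  have h1 := hf.2 (hc'.toSchwartzMap hu') hc'
  have h2 := hg.2 (hc'.toSchwartzMap hu') hc'
  simpa using h1.symm.trans h2

/-- A square-integrable representative, transferred to any other representative of the transform. -/
theorem InDom.memLp {ν : Measure ℝ} (hν : ν ≪ volume) {T : 𝓢'(ℝ, ℂ)} (hT : InDom ν T)
    {f : ℝ → ℂ} (hf : IsFunction (ftDist T) f) : MemLp f 2 ν := by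
  obtain ⟨g, hg, hg2⟩ := hT
  exact hg2.ae_eq (hν.ae_le (hg.ae_eq hf))

/-- Polynomial growth of the spectral measure makes Schwartz functions square-integrable. -/
theorem hasTemperateGrowth_of_lintegral {ν : Measure ℝ}
    (h : ∃ k : ℕ, ∫⁻ x : ℝ, ENNReal.ofReal (((1 + x ^ 2) ^ k)⁻¹) ∂ν < ⊤) :
    ν.HasTemperateGrowth := by
  obtain ⟨k, hk⟩ := h
  refine ⟨2 * k, ?_⟩
  have hc : Continuous fun x : ℝ => ((1 + x ^ 2) ^ k)⁻¹ :=
    Continuous.inv₀ (by fun_prop) fun x => by positivity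
  have hi : Integrable (fun x : ℝ => ((1 + x ^ 2) ^ k)⁻¹) ν :=
    ⟨hc.aestronglyMeasurable, by
      rw [hasFiniteIntegral_iff_ofReal (Eventually.of_forall fun x => by positivity)]
      exact hk⟩
  have hm : Continuous fun x : ℝ => (1 + ‖x‖) ^ (-((2 * k : ℕ) : ℝ)) :=
    Continuous.rpow_const (by fun_prop) fun x => Or.inl (by positivity)
  refine hi.mono' hm.aestronglyMeasurable (Eventually.of_forall fun x => ?_)
  rw [Real.norm_of_nonneg (by positivity), Real.rpow_neg (by positivity), Real.rpow_natCast,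
    pow_mul]
  gcongr
  rw [Real.norm_eq_abs, ← sq_abs x]
  nlinarith [abs_nonneg x]

theorem isLocallyFiniteMeasure_of_lintegral {ν : Measure ℝ}
    (h : ∃ k : ℕ, ∫⁻ x : ℝ, ENNReal.ofReal (((1 + x ^ 2) ^ k)⁻¹) ∂ν < ⊤) :
    IsLocallyFiniteMeasure ν := by
  obtain ⟨k, hk⟩ := h
  have hc : Continuous fun x : ℝ => ENNReal.ofReal (((1 + x ^ 2) ^ k)⁻¹) :=
    ENNReal.continuous_ofReal.comp (Continuous.inv₀ (by fun_prop) fun x => by positivity)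
  refine ⟨fun x => ?_⟩
  obtain ⟨c, hc0, hcx⟩ : ∃ c : ENNReal, c ≠ 0 ∧ c < ENNReal.ofReal (((1 + x ^ 2) ^ k)⁻¹) := by
    obtain ⟨c, h1, h2⟩ := exists_between
      (show (0 : ENNReal) < ENNReal.ofReal (((1 + x ^ 2) ^ k)⁻¹) from
        ENNReal.ofReal_pos.2 (by positivity))
    exact ⟨c, h1.ne', h2⟩
  refine ⟨{y | c ≤ ENNReal.ofReal (((1 + y ^ 2) ^ k)⁻¹)}, ?_, ?_⟩
  · filter_upwards [(hc.tendsto x).eventually (lt_mem_nhds hcx)] with y hy using hy.le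
  · exact (meas_ge_le_lintegral_div hc.aemeasurable hc0 (hcx.trans_le le_top).ne).trans_lt
      (ENNReal.div_lt_top hk.ne hc0)

/-! ### The weak equation in the frequency domain -/

/-- The Fourier symbol `i m ω + β ∫_0^∞ K(t) exp (-i t ω) dt` of the Langevin equation. -/
noncomputable def symbol (m β : ℝ) (K : ℝ → ℝ) (ω : ℝ) : ℂ :=
  Complex.I * m * ω + β * halfFT K (-ω)

section Drift

variable {Ω : Type*} [MeasurableSpace Ω] {P : Measure Ω} {m β : ℝ} {ν : Measure ℝ}
  {V : 𝓢'(ℝ, ℂ) →ₗ.[ℂ] Lp ℂ 2 P}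

theorem TailBound.measurable_symbol (h : TailBound K A C) (m β : ℝ) :
    Measurable (symbol m β K) := by
  have := h.measurable_halfFT
  unfold symbol
  fun_prop

theorem TailBound.memLp_halfFT_mul_ft (h : TailBound K A C) (hV : IsWeakSolution m β K P ν V)
    (φ : 𝓢(ℝ, ℂ)) : MemLp (fun ω => halfFT K ω * ft φ ω) 2 ν := by
  obtain ⟨T, hT, hTi⟩ := hV.conv_mem φ
  exact ((hV.stationary.mem_domain T).1 hT).memLp hV.stationary.absolutelyContinuous
    (h.isFunction_ftDist_convPlus hTi)

theorem TailBound.memLp_symbol_mul_ft (h : TailBound K A C) (hV : IsWeakSolution m β K P ν V)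
    (φ : 𝓢(ℝ, ℂ)) : MemLp (fun ω => symbol m β K ω * ft φ ω) 2 ν := by
  have := hasTemperateGrowth_of_lintegral hV.stationary.growth
  have h1 : MemLp (fun ω => -(m : ℂ) * ft (SchwartzMap.derivCLM ℂ ℂ φ) ω) 2 ν :=
    ((ft (SchwartzMap.derivCLM ℂ ℂ φ)).memLp 2 ν).const_mul _
  have hmeas : Measurable fun ω => halfFT K (-ω) := h.measurable_halfFT.comp measurable_neg
  have h2 : MemLp (fun ω => halfFT K (-ω) * ft φ ω) 2 ν := by
    refine (h.memLp_halfFT_mul_ft hV φ).congr_norm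
      (hmeas.aestronglyMeasurable.mul (ft φ).continuous.aestronglyMeasurable) ?_
    filter_upwards [hV.stationary.absolutelyContinuous.ae_le (Measure.ae_ne volume 0)] with ω hω
    rw [norm_mul, norm_mul, h.halfFT_neg hω, RCLike.norm_conj]
  refine (h1.add (h2.const_mul (β : ℂ))).ae_eq (Eventually.of_forall fun ω => ?_)
  simp only [Pi.add_apply, ft_deriv, symbol]
  ring

/-- The drift `-mφ' + β (K⁺ * φ̃)~` is a tempered distribution in the domain of `V`, with Fourier
transform `symbol · ft φ`. -/
theorem TailBound.exists_drift (h : TailBound K A C) (hV : IsWeakSolution m β K P ν V)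
    (φ : 𝓢(ℝ, ℂ)) : ∃ S : V.domain, IsIntegrationAgainst S (testDrift m β K φ) ∧
      IsFunction (ftDist S) (fun ω => symbol m β K ω * ft φ ω) := by
  obtain ⟨T, -, hT⟩ := hV.conv_mem (reflectCLM φ)
  set φ' := SchwartzMap.derivCLM ℂ ℂ φ
  set S : 𝓢'(ℝ, ℂ) := -(m : ℂ) • SchwartzMap.toTemperedDistributionCLM ℝ ℂ volume φ' +
    (β : ℂ) • PointwiseConvergenceCLM.precomp ℂ reflectCLM T
  have hS : ∀ χ, S χ = -(m : ℂ) * (∫ t, χ t * φ' t) + β * T (reflectCLM χ) := fun χ => by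
    have := SchwartzMap.toTemperedDistributionCLM_apply_apply volume φ' χ
    simp only [smul_eq_mul] at this
    rw [← this]
    rfl
  have hprod : ∀ χ : 𝓢(ℝ, ℂ), Integrable fun t => χ t * φ' t := fun χ =>
    (schwartzMul χ φ').integrable
  have hSi : IsIntegrationAgainst S (testDrift m β K φ) := fun χ => by
    have e : ∀ t, χ t * testDrift m β K φ t =
        -(m : ℂ) * (χ t * φ' t) + β * (χ t * convPlus K (reflectCLM φ) (-t)) := fun t => by
      simp only [testDrift, ← coe_reflectCLM, reflect, φ', SchwartzMap.derivCLM_apply]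
      ring
    have h1 : Integrable fun t => χ t * convPlus K (reflectCLM φ) (-t) := by
      simpa using (hT (reflectCLM χ)).1.comp_neg
    have h2 : T (reflectCLM χ) = ∫ t, χ t * convPlus K (reflectCLM φ) (-t) := by
      rw [(hT _).2, ← integral_neg_eq_self]
      simp
    simp_rw [e]
    refine ⟨((hprod χ).const_mul _).add (h1.const_mul _), ?_⟩
    rw [integral_add ((hprod χ).const_mul _) (h1.const_mul _), integral_const_mul,
      integral_const_mul, hS, h2]
  have hSf : IsFunction (ftDist S) (fun ω => symbol m β K ω * ft φ ω) := by
    have hneg : LocallyIntegrable (fun ω => halfFT K (-ω)) volume := by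
      refine (h.locallyIntegrable_halfFT.mono
        (h.measurable_halfFT.comp measurable_neg).aestronglyMeasurable ?_)
      filter_upwards [Measure.ae_ne volume 0] with ω hω
      rw [h.halfFT_neg hω, RCLike.norm_conj]
    refine ⟨LocallyIntegrable.mul_continuous (ft φ).continuous ?_, fun χ _ => ?_⟩
    · refine LocallyIntegrable.add (Continuous.locallyIntegrable (by fun_prop)) (hneg.smul (β : ℂ))
    · have h1 : T (reflectCLM (ft χ)) = ∫ ω, χ ω * (halfFT K (-ω) * ft φ ω) := by
        rw [← ft_reflectCLM, ← ftDist_apply, h.ftDist_convPlus_apply hT, ← integral_neg_eq_self]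
        simp [ft_reflectCLM]
      have h2 : ∫ t, ft χ t * φ' t = ∫ ω, χ ω * ft φ' ω := by
        rw [integral_ft_mul_eq χ φ'.integrable]
        simp_rw [← ft_eq_integral_expI]
      have i1 : Integrable fun ω => χ ω * (halfFT K (-ω) * ft φ ω) := by
        refine (h.integrable_schwartz_mul_halfFT
          (reflectCLM (schwartzMul χ (ft φ)))).comp_neg.congr (Eventually.of_forall fun ω => ?_)
        simp only [reflectCLM_apply, schwartzMul_apply, neg_neg]; ring
      have i2 : Integrable fun ω => χ ω * ft φ' ω := (schwartzMul χ (ft φ')).integrable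
      rw [ftDist_apply, hS, h1, h2, ← integral_const_mul, ← integral_const_mul,
        ← integral_add (i2.const_mul _) (i1.const_mul _)]
      congr 1; ext ω
      simp only [φ', ft_deriv, symbol]
      ring
  refine ⟨⟨S, (hV.stationary.mem_domain S).2 ⟨_, hSf, h.memLp_symbol_mul_ft hV φ⟩⟩, hSi, hSf⟩

/-- The covariance of the forcing in the frequency domain. -/
theorem TailBound.forcingCov_ftInv (h : TailBound K A C) (heven : ∀ t, K (-t) = K t)
    (a b : 𝓢(ℝ, ℂ)) (hb : ∀ x, conj (b x) = b x) :
    forcingCov K (ftInv a) (ftInv b) = ∫ ω, a ω * b ω * (((halfFT K ω).re / Real.pi : ℝ) : ℂ) := by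
  obtain ⟨θ, hθ⟩ : ∃ θ, θ = reflectCLM (schwartzMul a b) := ⟨_, rfl⟩
  have inner : ∀ t, ∫ s, ftInv a s * conj (ftInv b (s - t)) =
      (2 * Real.pi : ℂ)⁻¹ * ft θ t := fun t => by
    have e : schwartzMul (reflectCLM a) (ft (reflectCLM (ftInv b))) = θ := by
      ext x
      simp [ft_reflectCLM, ft_ftInv, hθ]
    rw [← e, ← integral_ft_mul_translate, ← integral_const_mul]
    congr 1; ext s
    rw [conj_ftInv hb, reflectCLM_apply, ftInv, smul_apply, smul_eq_mul, mul_assoc]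
  have hneg : ∀ t, ft θ (-t) = ft (reflectCLM θ) t := fun t => by
    rw [ft_reflectCLM, reflectCLM_apply]
  have i1 := h.integrableOn_mul_schwartz (ft θ)
  have i2 : IntegrableOn (fun t => (K t : ℂ) * ft θ t) (Set.Iic 0) := by
    have := h.integrableOn_mul_schwartz (ft (reflectCLM θ))
    rw [← integrableOn_Ici_iff_integrableOn_Ioi, ← neg_zero] at this
    refine this.comp_neg_Iic.congr (Eventually.of_forall fun t => ?_)
    simp only [heven, ← hneg, neg_neg]
  have split : ∫ t, (K t : ℂ) * ft θ t = ∫ ω, θ ω * (halfFT K ω + halfFT K (-ω)) := by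
    rw [← intervalIntegral.integral_Iic_add_Ioi i2 i1]
    have e1 : ∫ t in Set.Iic (0 : ℝ), (K t : ℂ) * ft θ t =
        ∫ t in Set.Ioi (0 : ℝ), (K t : ℂ) * ft (reflectCLM θ) t := by
      have := integral_comp_neg_Ioi (0 : ℝ) (fun t => (K t : ℂ) * ft θ t)
      rw [neg_zero] at this
      rw [← this]
      simp [heven, hneg]
    rw [e1, h.integral_mul_ft, h.integral_mul_ft, ← integral_neg_eq_self
      (fun ω => (reflectCLM θ) ω * halfFT K ω), add_comm]
    simp only [reflectCLM_apply, neg_neg, mul_add]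
    refine (integral_add (h.integrable_schwartz_mul_halfFT θ) ?_).symm
    simpa using (h.integrable_schwartz_mul_halfFT (reflectCLM θ)).comp_neg
  rw [forcingCov]
  simp_rw [inner]
  calc ∫ t, (K t : ℂ) * ((2 * Real.pi : ℂ)⁻¹ * ft θ t)
      = (2 * Real.pi : ℂ)⁻¹ * ∫ t, (K t : ℂ) * ft θ t := by
        rw [← integral_const_mul]; congr 1; ext t; ring
    _ = ∫ ω, (2 * Real.pi : ℂ)⁻¹ * (θ ω * (halfFT K ω + halfFT K (-ω))) := by
        rw [split, integral_const_mul]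
    _ = ∫ ω, (2 * Real.pi : ℂ)⁻¹ * (θ (-ω) * (halfFT K (-ω) + halfFT K ω)) := by
        rw [← integral_neg_eq_self]; simp
    _ = _ := by
        refine integral_congr_ae ?_
        filter_upwards [Measure.ae_ne volume 0] with ω hω
        have hpi : (Real.pi : ℂ) ≠ 0 := by exact_mod_cast Real.pi_ne_zero
        rw [h.halfFT_neg hω, add_comm, Complex.add_conj]
        simp only [hθ, reflectCLM_apply, schwartzMul_apply, neg_neg]
        push_cast; field_simp

/-- The weak form of the equation, in the frequency domain. -/
theorem TailBound.integral_symbol_sq (h : TailBound K A C) (heven : ∀ t, K (-t) = K t)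
    (hV : IsWeakSolution m β K P ν V) (a b : 𝓢(ℝ, ℂ)) (hb : ∀ x, conj (b x) = b x) :
    ∫ ω, a ω * b ω * ((‖symbol m β K ω‖ ^ 2 : ℝ) : ℂ) ∂ν =
      ∫ ω, a ω * b ω * ((β * (halfFT K ω).re / Real.pi : ℝ) : ℂ) := by
  obtain ⟨S, hS, hSf⟩ := h.exists_drift hV (ftInv a)
  obtain ⟨T, hT, hTf⟩ := h.exists_drift hV (ftInv b)
  have e1 := hV.weak_eq _ _ S T hS hT
  rw [hV.stationary.covariance S T _ _ hSf hTf, h.forcingCov_ftInv heven a b hb,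
    ← integral_const_mul] at e1
  convert e1 using 1
  · congr 1; ext ω
    rw [ft_ftInv, ft_ftInv, map_mul, hb]
    push_cast
    rw [← Complex.mul_conj']
    ring
  · congr 1; ext ω
    push_cast; ring

end Drift

/-! ### The spectral density -/

variable {m β : ℝ}

/-- The density `(β / π) Re k / |symbol|²`, `k = halfFT K`, of the spectral measure of a weak
solution. -/
noncomputable def spectralDensity (m β : ℝ) (K : ℝ → ℝ) (ω : ℝ) : ℝ :=
  β * (halfFT K ω).re / Real.pi / ‖symbol m β K ω‖ ^ 2

theorem TailBound.symbol_re (h : TailBound K A C) (m β : ℝ) {ω : ℝ} (hω : ω ≠ 0) :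
    (symbol m β K ω).re = β * (halfFT K ω).re := by
  simp [symbol, h.halfFT_neg hω]

theorem TailBound.symbol_im (h : TailBound K A C) (m β : ℝ) {ω : ℝ} (hω : ω ≠ 0) :
    (symbol m β K ω).im = m * ω - β * (halfFT K ω).im := by
  simp [symbol, h.halfFT_neg hω]
  ring

theorem TailBound.symbol_ne_zero (h : TailBound K A C) (hβ : 0 < β)
    (hpos : ∀ ω, ω ≠ 0 → 0 < (halfFT K ω).re) {ω : ℝ} (hω : ω ≠ 0) : symbol m β K ω ≠ 0 := by
  intro h0
  have := h.symbol_re m β hω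
  rw [h0, Complex.zero_re] at this
  exact (mul_pos hβ (hpos ω hω)).ne this

theorem spectralDensity_nonneg (hβ : 0 < β) (hpos : ∀ ω, ω ≠ 0 → 0 < (halfFT K ω).re) {ω : ℝ}
    (hω : ω ≠ 0) : 0 ≤ spectralDensity m β K ω := by
  have := (hpos ω hω).le
  have := Real.pi_pos
  unfold spectralDensity
  positivity

theorem TailBound.measurable_spectralDensity (h : TailBound K A C) (m β : ℝ) :
    Measurable (spectralDensity m β K) := by
  have := h.measurable_halfFT
  have := h.measurable_symbol m β
  have h3 : Measurable fun ω => (halfFT K ω).re := Complex.measurable_re.comp h.measurable_halfFT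
  unfold spectralDensity
  fun_prop

theorem TailBound.continuousAt_spectralDensity (h : TailBound K A C) (hβ : 0 < β)
    (hpos : ∀ ω, ω ≠ 0 → 0 < (halfFT K ω).re) {ω : ℝ} (hω : ω ≠ 0) :
    ContinuousAt (spectralDensity m β K) ω := by
  have h1 := h.continuousAt_halfFT hω
  have h2 : ContinuousAt (fun x => halfFT K (-x)) ω :=
    ContinuousAt.comp (f := fun x : ℝ => -x) (g := halfFT K)
      (h.continuousAt_halfFT (neg_ne_zero.2 hω)) continuousAt_neg
  have h3 : ContinuousAt (symbol m β K) ω := by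
    unfold symbol
    exact ContinuousAt.add (by fun_prop) (continuousAt_const.mul h2)
  have h4 : ContinuousAt (fun x => (halfFT K x).re) ω := Complex.continuous_re.continuousAt.comp h1
  refine ContinuousAt.div (by fun_prop) (by fun_prop) ?_
  have := norm_pos_iff.2 (h.symbol_ne_zero (m := m) hβ hpos hω)
  positivity

section Density

variable {Ω : Type*} [MeasurableSpace Ω] {P : Measure Ω} {ν : Measure ℝ}
  {V : 𝓢'(ℝ, ℂ) →ₗ.[ℂ] Lp ℂ 2 P}

/-- A real-valued smooth bump equal to `1` on `[-n, n]`, as a Schwartz function. -/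
theorem exists_schwartz_eq_one (n : ℝ) : ∃ b : 𝓢(ℝ, ℂ), (∀ x, conj (b x) = b x) ∧
    ∀ x ∈ Metric.closedBall (0 : ℝ) n, b x = 1 := by
  let f : ContDiffBump (0 : ℝ) := ⟨max n 1, max n 1 + 1, by positivity, by linarith⟩
  have hc : HasCompactSupport (fun x => (f x : ℂ)) :=
    f.hasCompactSupport.comp_left (g := Complex.ofReal) rfl
  have hs : ContDiff ℝ (⊤ : ℕ∞) (fun x => (f x : ℂ)) := Complex.ofRealCLM.contDiff.comp f.contDiff
  refine ⟨hc.toSchwartzMap hs, fun x => Complex.conj_ofReal _, fun x hx => ?_⟩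
  have : f x = 1 := f.one_of_mem_closedBall
    (Metric.closedBall_subset_closedBall (le_max_left n 1) hx)
  change (f x : ℂ) = 1
  rw [this, Complex.ofReal_one]

/-- The spectral measure of a weak solution has density `spectralDensity`. -/
theorem TailBound.rnDeriv_ae_eq (h : TailBound K A C) (hβ : 0 < β) (heven : ∀ t, K (-t) = K t)
    (hpos : ∀ ω, ω ≠ 0 → 0 < (halfFT K ω).re) (hV : IsWeakSolution m β K P ν V) :
    ∀ᵐ ω, (ν.rnDeriv volume ω).toReal = spectralDensity m β K ω := by
  have hac := hV.stationary.absolutelyContinuous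
  have := isLocallyFiniteMeasure_of_lintegral hV.stationary.growth
  set ρ : ℝ → ℝ := fun ω => (ν.rnDeriv volume ω).toReal
  have hρ : ∀ f : ℝ → ℂ, Integrable (fun ω => ρ ω • f ω) ↔ Integrable f ν := fun f =>
    integrable_rnDeriv_smul_iff hac
  set F : ℝ → ℂ := fun ω => ρ ω • ((‖symbol m β K ω‖ ^ 2 : ℝ) : ℂ)
  set G : ℝ → ℂ := fun ω => ((β * (halfFT K ω).re / Real.pi : ℝ) : ℂ)
  have hsq : ∀ b : 𝓢(ℝ, ℂ), Integrable (fun ω => ‖symbol m β K ω * b ω‖ ^ 2) ν := fun b => by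
    have := h.memLp_symbol_mul_ft hV (ftInv b)
    rw [ft_ftInv] at this
    exact (memLp_two_iff_integrable_sq_norm this.1).1 this
  -- `symbol · b` is square-integrable for `ν`, and `b` can be chosen to be `1` near any given point
  have hF : LocallyIntegrable F volume := by
    refine fun x => ⟨Metric.closedBall 0 (|x| + 1), ?_, ?_⟩
    · exact mem_of_superset (Metric.isOpen_ball.mem_nhds (by simp)) Metric.ball_subset_closedBall
    · obtain ⟨b, -, hb⟩ := exists_schwartz_eq_one (|x| + 1)
      have h1 := ((hρ _).2 (hsq b).ofReal).integrableOn (s := Metric.closedBall 0 (|x| + 1))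
      refine h1.congr_fun (fun y hy => ?_) measurableSet_closedBall
      simp only [F, hb y hy, mul_one]
      rfl
  have hG : LocallyIntegrable G volume := by
    refine (h.locallyIntegrable_halfFT.smul (β / Real.pi)).mono ?_
      (Eventually.of_forall fun ω => ?_)
    · have h3 : Measurable fun ω => (halfFT K ω).re :=
        Complex.measurable_re.comp h.measurable_halfFT
      exact (Complex.measurable_ofReal.comp
        ((h3.const_mul β).div_const Real.pi)).aestronglyMeasurable
    · simp only [G, Pi.smul_apply, norm_smul, Complex.norm_real]
      rw [mul_div_right_comm, norm_mul]
      exact mul_le_mul_of_nonneg_left (Complex.abs_re_le_norm _) (norm_nonneg _)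
  have hFG : ∀ᵐ ω, F ω = G ω := by
    refine ae_eq_of_integral_contDiff_smul_eq hF hG fun u hu hc => ?_
    have hc' : HasCompactSupport (fun x => (u x : ℂ)) := hc.comp_left (g := Complex.ofReal) rfl
    have hu' : ContDiff ℝ (⊤ : ℕ∞) (fun x => (u x : ℂ)) := Complex.ofRealCLM.contDiff.comp hu
    obtain ⟨n, hn⟩ := hc.isCompact.isBounded.subset_closedBall (0 : ℝ)
    -- testing the weak equation with `u` and with a function equal to `1` on the support of `u`
    obtain ⟨b, hb, hb1⟩ := exists_schwartz_eq_one n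
    have hub : ∀ x, (u x : ℂ) * b x = u x := fun x => by
      by_cases hx : x ∈ tsupport u
      · rw [hb1 x (hn hx), mul_one]
      · rw [image_eq_zero_of_notMem_tsupport hx]; simp
    have key := h.integral_symbol_sq heven hV (hc'.toSchwartzMap hu') b hb
    change ∫ ω, (u ω : ℂ) * b ω * _ ∂ν = ∫ ω, (u ω : ℂ) * b ω * _ at key
    simp only [hub] at key
    rw [← integral_rnDeriv_smul hac] at key
    simp only [F, G, Complex.real_smul]
    simp only [Complex.real_smul] at key
    rw [← key]
    congr 1; ext ω; ring
  filter_upwards [hFG, Measure.ae_ne volume 0] with ω hω h0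
  have hs := norm_pos_iff.2 (h.symbol_ne_zero (m := m) hβ hpos h0)
  have h2 : ρ ω * ‖symbol m β K ω‖ ^ 2 = β * (halfFT K ω).re / Real.pi := by
    simp only [F, G, Complex.real_smul] at hω
    exact_mod_cast hω
  rw [spectralDensity, eq_div_iff (by positivity)]
  exact h2

theorem TailBound.integrable_iff_spectralDensity (h : TailBound K A C) (hβ : 0 < β)
    (heven : ∀ t, K (-t) = K t) (hpos : ∀ ω, ω ≠ 0 → 0 < (halfFT K ω).re)
    (hV : IsWeakSolution m β K P ν V) (f : ℝ → ℝ) :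
    Integrable f ν ↔ Integrable fun ω => spectralDensity m β K ω * f ω := by
  have := isLocallyFiniteMeasure_of_lintegral hV.stationary.growth
  rw [← integrable_rnDeriv_smul_iff hV.stationary.absolutelyContinuous]
  refine integrable_congr ?_
  filter_upwards [h.rnDeriv_ae_eq hβ heven hpos hV] with ω hω
  rw [hω, smul_eq_mul]

theorem TailBound.integral_eq_spectralDensity (h : TailBound K A C) (hβ : 0 < β)
    (heven : ∀ t, K (-t) = K t) (hpos : ∀ ω, ω ≠ 0 → 0 < (halfFT K ω).re)
    (hV : IsWeakSolution m β K P ν V) (f : ℝ → ℝ) :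
    ∫ ω, f ω ∂ν = ∫ ω, spectralDensity m β K ω * f ω := by
  have := isLocallyFiniteMeasure_of_lintegral hV.stationary.growth
  rw [← integral_rnDeriv_smul hV.stationary.absolutelyContinuous]
  refine integral_congr_ae ?_
  filter_upwards [h.rnDeriv_ae_eq hβ heven hpos hV] with ω hω
  rw [hω, smul_eq_mul]

end Density

/-! ### Behaviour of the spectral density at zero frequency -/

theorem tendsto_inv_abs_nhdsNE_zero : Tendsto (fun ω : ℝ => |ω|⁻¹) (𝓝[≠] 0) atTop :=
  tendsto_inv_nhdsGT_zero.comp tendsto_abs_nhdsNE_zero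

/-- The half-line transform of a kernel with tail `c / t` has the singularity `c log (1 / |ω|)`. -/
theorem TailBound.tendsto_halfFT_div_log (h : TailBound K A C) {c : ℝ}
    (hc : Tendsto (fun t => K t / t⁻¹) atTop (𝓝 c)) :
    Tendsto (fun ω => halfFT K ω / (Real.log |ω|⁻¹ : ℝ)) (𝓝[≠] 0) (𝓝 (c : ℂ)) := by
  have hlog := Real.tendsto_log_atTop.comp tendsto_inv_abs_nhdsNE_zero
  have h1 : Tendsto (fun ω : ℝ => (((∫ t in (0 : ℝ)..|ω|⁻¹, K t) / Real.log |ω|⁻¹ : ℝ) : ℂ))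
      (𝓝[≠] 0) (𝓝 (c : ℂ)) :=
    (Complex.continuous_ofReal.tendsto _).comp
      ((tendsto_integral_div_log h.locInt hc).comp tendsto_inv_abs_nhdsNE_zero)
  set D := (∫ t in (0 : ℝ)..A, K t) + C + 3 * Real.pi / 2 * C
  have h2 : Tendsto (fun ω : ℝ => (halfFT K ω - ((∫ t in (0 : ℝ)..|ω|⁻¹, K t : ℝ) : ℂ)) /
      (Real.log |ω|⁻¹ : ℝ)) (𝓝[≠] 0) (𝓝 0) := by
    rw [tendsto_zero_iff_norm_tendsto_zero]
    refine squeeze_zero' (g := fun ω : ℝ => D / Real.log |ω|⁻¹)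
      (Eventually.of_forall fun ω => norm_nonneg _) ?_ (tendsto_const_nhds.div_atTop hlog)
    filter_upwards [tendsto_inv_abs_nhdsNE_zero.eventually (eventually_ge_atTop A),
      hlog.eventually (eventually_gt_atTop 0), self_mem_nhdsWithin] with ω hA hl hω
    have hω : ω ≠ 0 := hω
    have hl : 0 < Real.log |ω|⁻¹ := hl
    rw [norm_div, Complex.norm_real, Real.norm_of_nonneg hl.le]
    exact div_le_div_of_nonneg_right
      (h.norm_halfFT_sub_integral_le hA (mul_inv_cancel₀ (abs_pos.2 hω).ne')) hl.le
  have := h1.add h2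
  rw [add_zero] at this
  refine this.congr fun ω => ?_
  push_cast
  rw [← add_div, add_sub_cancel]

/-- At zero frequency the spectral density vanishes like `1 / (π β c log (1 / |ω|))`. -/
theorem TailBound.tendsto_spectralDensity_mul_log (h : TailBound K A C) (hβ : 0 < β) {c : ℝ}
    (hc0 : 0 < c) (hc : Tendsto (fun t => K t / t⁻¹) atTop (𝓝 c)) :
    Tendsto (fun ω => spectralDensity m β K ω * Real.log |ω|⁻¹) (𝓝[≠] 0)
      (𝓝 (1 / (Real.pi * β * c))) := by
  have hlog := Real.tendsto_log_atTop.comp tendsto_inv_abs_nhdsNE_zero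
  have h1 := h.tendsto_halfFT_div_log hc
  have h2 : Tendsto (fun ω => (halfFT K ω / (Real.log |ω|⁻¹ : ℝ)).re) (𝓝[≠] 0) (𝓝 c) :=
    (Complex.continuous_re.tendsto _).comp h1
  have h3 : Tendsto (fun ω => conj (halfFT K ω / (Real.log |ω|⁻¹ : ℝ))) (𝓝[≠] 0) (𝓝 (c : ℂ)) := by
    have := (Complex.continuous_conj.tendsto _).comp h1
    rwa [Complex.conj_ofReal] at this
  have h4 : Tendsto (fun ω : ℝ => (m * ω) / Real.log |ω|⁻¹) (𝓝[≠] 0) (𝓝 0) := by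
    refine Tendsto.div_atTop (a := 0) ?_ hlog
    have : Tendsto (fun ω : ℝ => m * ω) (𝓝 0) (𝓝 (m * 0)) := tendsto_id.const_mul m
    rw [mul_zero] at this
    exact this.mono_left nhdsWithin_le_nhds
  have h5 : Tendsto (fun ω : ℝ => Complex.I * ((m * ω / Real.log |ω|⁻¹ : ℝ) : ℂ) +
      β * conj (halfFT K ω / (Real.log |ω|⁻¹ : ℝ))) (𝓝[≠] 0)
      (𝓝 (Complex.I * ((0 : ℝ) : ℂ) + β * (c : ℂ))) :=
    (((Complex.continuous_ofReal.tendsto _).comp h4).const_mul _).add (h3.const_mul _)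
  have hlim : 1 / (Real.pi * β * c) =
      β * c / Real.pi / ‖Complex.I * ((0 : ℝ) : ℂ) + β * (c : ℂ)‖ ^ 2 := by
    have e : Complex.I * ((0 : ℝ) : ℂ) + β * (c : ℂ) = ((β * c : ℝ) : ℂ) := by push_cast; ring
    have := Real.pi_pos
    rw [e, Complex.norm_real, Real.norm_of_nonneg (by positivity)]
    field_simp
  rw [hlim]
  refine (((h2.const_mul β).div_const Real.pi).div (h5.norm.pow 2) ?_).congr' ?_
  · have e : Complex.I * ((0 : ℝ) : ℂ) + β * (c : ℂ) = ((β * c : ℝ) : ℂ) := by push_cast; ring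
    rw [e, Complex.norm_real, Real.norm_of_nonneg (by positivity)]
    positivity
  · filter_upwards [hlog.eventually (eventually_gt_atTop 0), self_mem_nhdsWithin] with ω hl hω
    have hω : ω ≠ 0 := hω
    have hl : 0 < Real.log |ω|⁻¹ := hl
    have e : Complex.I * ((m * ω / Real.log |ω|⁻¹ : ℝ) : ℂ) +
        β * conj (halfFT K ω / (Real.log |ω|⁻¹ : ℝ)) = symbol m β K ω / (Real.log |ω|⁻¹ : ℝ) := by
      rw [symbol, h.halfFT_neg hω, map_div₀, Complex.conj_ofReal]
      push_cast; ring
    rw [Pi.div_apply, e, spectralDensity, Complex.div_ofReal_re, norm_div, Complex.norm_real,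
      Real.norm_of_nonneg hl.le]
    rcases eq_or_ne (‖symbol m β K ω‖) 0 with h0 | h0
    · simp [h0]
    · field_simp

/-- A global bound on the spectral density that keeps its logarithmic decay at zero frequency. -/
theorem TailBound.exists_spectralDensity_le (h : TailBound K A C) (hm : 0 < m) (hβ : 0 < β)
    (hpos : ∀ ω, ω ≠ 0 → 0 < (halfFT K ω).re) {c : ℝ} (hc0 : 0 < c)
    (hc : Tendsto (fun t => K t / t⁻¹) atTop (𝓝 c)) :
    ∃ M, ∀ ω, ω ≠ 0 → spectralDensity m β K ω ≤ M ∧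
      spectralDensity m β K ω * Real.posLog |ω|⁻¹ ≤ M := by
  have hnn : ∀ ω, ω ≠ 0 → 0 ≤ spectralDensity m β K ω := fun ω hω =>
    spectralDensity_nonneg hβ hpos hω
  have hlog := Real.tendsto_log_atTop.comp tendsto_inv_abs_nhdsNE_zero
  -- low frequencies
  obtain ⟨δ, hδ, hsmall⟩ : ∃ δ > 0, ∀ ω, ω ≠ 0 → |ω| < δ →
      spectralDensity m β K ω ≤ 1 / (Real.pi * β * c) + 1 ∧
      spectralDensity m β K ω * Real.posLog |ω|⁻¹ ≤ 1 / (Real.pi * β * c) + 1 := by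
    have ev := ((h.tendsto_spectralDensity_mul_log (m := m) hβ hc0 hc).eventually
      (ge_mem_nhds (lt_add_one _))).and (hlog.eventually (eventually_ge_atTop 1))
    rw [eventually_nhdsWithin_iff, Metric.eventually_nhds_iff] at ev
    obtain ⟨δ, hδ, hev⟩ := ev
    refine ⟨δ, hδ, fun ω hω hlt => ?_⟩
    obtain ⟨h1, h2⟩ := hev (by simpa [Real.dist_eq] using hlt) hω
    have h2 : 1 ≤ Real.log |ω|⁻¹ := h2
    refine ⟨?_, ?_⟩
    · exact (le_mul_of_one_le_right (hnn ω hω) h2).trans h1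
    · rwa [Real.posLog_apply, max_eq_right (by linarith)]
  -- high frequencies, where the inertial term `i m ω` dominates the symbol
  set B := ((∫ t in (0 : ℝ)..A, K t) + 2 * C * √A + 3 * Real.pi / 2 * C) + 2 * C
  have hB : ∀ ω : ℝ, 1 ≤ |ω| → ‖halfFT K ω‖ ≤ B := fun ω hω => by
    have hω0 : ω ≠ 0 := abs_pos.1 (zero_lt_one.trans_le hω)
    refine (h.norm_halfFT_le hω0).trans ?_
    have hr : |ω| ^ (-(1 / 2) : ℝ) ≤ 1 := Real.rpow_le_one_of_one_le_of_nonpos hω (by norm_num)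
    have := mul_le_mul_of_nonneg_left hr (mul_nonneg zero_le_two h.C_pos.le)
    simp only [B]
    linarith
  have hB0 : 0 ≤ B := (norm_nonneg _).trans (hB 1 (by simp))
  set N := max 1 ((1 + β * B) / m)
  have hlarge : ∀ ω, N ≤ |ω| → spectralDensity m β K ω ≤ β * B / Real.pi := fun ω hN => by
    have h1 : 1 ≤ |ω| := (le_max_left _ _).trans hN
    have hω0 : ω ≠ 0 := abs_pos.1 (zero_lt_one.trans_le h1)
    have h2 : 1 + β * B ≤ m * |ω| := by
      have := (le_max_right _ _).trans hN
      rw [div_le_iff₀ hm] at this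
      linarith
    have h3 : 1 ≤ ‖symbol m β K ω‖ := by
      refine le_trans ?_ (Complex.abs_im_le_norm _)
      rw [h.symbol_im m β hω0]
      have h4 : |β * (halfFT K ω).im| ≤ β * B := by
        rw [abs_mul, abs_of_pos hβ]
        exact mul_le_mul_of_nonneg_left ((Complex.abs_im_le_norm _).trans (hB ω h1)) hβ.le
      have h5 := abs_sub_abs_le_abs_sub (m * ω) (β * (halfFT K ω).im)
      rw [abs_mul, abs_of_pos hm] at h5
      linarith
    have h6 : (halfFT K ω).re ≤ B := (Complex.re_le_norm _).trans (hB ω h1)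
    have h7 := hpos ω hω0
    have h8 := Real.pi_pos
    calc spectralDensity m β K ω ≤ β * (halfFT K ω).re / Real.pi :=
          div_le_self (by positivity) (one_le_pow₀ h3)
      _ ≤ _ := by gcongr
  -- intermediate frequencies, by compactness
  obtain ⟨Q, hQ⟩ : ∃ Q, ∀ ω, δ ≤ |ω| → |ω| ≤ N → spectralDensity m β K ω ≤ Q := by
    have hcpt : IsCompact (Metric.closedBall (0 : ℝ) N ∩ {ω | δ ≤ |ω|}) :=
      (isCompact_closedBall 0 N).inter_right (isClosed_le continuous_const continuous_abs)
    obtain ⟨Q, hQ⟩ := hcpt.bddAbove_image (f := spectralDensity m β K) fun ω hω =>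
      (h.continuousAt_spectralDensity hβ hpos (abs_pos.1 (hδ.trans_le hω.2))).continuousWithinAt
    exact ⟨Q, fun ω h1 h2 => hQ ⟨ω, ⟨by simpa [Real.dist_eq] using h2, h1⟩, rfl⟩⟩
  set R := max Q (β * B / Real.pi)
  have hbig : ∀ ω, δ ≤ |ω| → spectralDensity m β K ω ≤ R := fun ω h1 => by
    rcases le_total |ω| N with h2 | h2
    · exact (hQ ω h1 h2).trans (le_max_left _ _)
    · exact (hlarge ω h2).trans (le_max_right _ _)
  have hR : 0 ≤ R := le_trans (by have := Real.pi_pos; positivity) (le_max_right _ _)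
  have hL : 0 ≤ 1 / (Real.pi * β * c) + 1 := by have := Real.pi_pos; positivity
  have hp := Real.posLog_nonneg (x := δ⁻¹)
  refine ⟨(1 / (Real.pi * β * c) + 1) + R * (1 + Real.posLog δ⁻¹), fun ω hω => ?_⟩
  have hRp := mul_nonneg hR hp
  rcases lt_or_ge |ω| δ with h1 | h1
  · obtain ⟨h2, h3⟩ := hsmall ω hω h1
    constructor <;> linarith
  · have h2 := hbig ω h1
    have h3 : Real.posLog |ω|⁻¹ ≤ Real.posLog δ⁻¹ :=
      Real.posLog_le_posLog (by positivity) (inv_anti₀ hδ h1)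
    have h4 := mul_le_mul h2 h3 Real.posLog_nonneg hR
    constructor <;> linarith

/-! ### Indicator functions and the growth of the variance -/

/-- The transform `∫_0^t exp (i s ω) ds` of the indicator function of `[0, t]`. -/
noncomputable def indicatorFT (t ω : ℝ) : ℂ := ∫ s in (0 : ℝ)..t, expI ω s

theorem continuous_indicatorFT (t : ℝ) : Continuous (indicatorFT t) := by
  refine intervalIntegral.continuous_parametric_intervalIntegral_of_continuous' ?_ 0 t
  exact continuous_expI

theorem isFunction_ftDist_indicatorDist {t : ℝ} (ht : 0 ≤ t) :
    IsFunction (ftDist (indicatorDist t)) (indicatorFT t) := by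
  refine ⟨(continuous_indicatorFT t).locallyIntegrable, fun χ _ => ?_⟩
  have hi : Integrable ((Set.Icc 0 t).indicator fun _ => (1 : ℂ)) :=
    (integrable_indicator_iff measurableSet_Icc).2 (by simp)
  rw [ftDist_apply, indicatorDist, Lp.toTemperedDistribution_apply]
  calc _ = ∫ x, ft χ x * (Set.Icc 0 t).indicator (fun _ => (1 : ℂ)) x := by
        refine integral_congr_ae ?_
        filter_upwards [indicatorConstLp_coeFn (μ := (volume : Measure ℝ)) (p := 1)
          (s := Set.Icc 0 t) (hs := measurableSet_Icc) (hμs := measure_Icc_lt_top.ne)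
          (c := (1 : ℂ))] with x hx
        rw [hx, smul_eq_mul]
    _ = _ := by
        rw [integral_ft_mul_eq χ hi]
        congr 1; ext ω
        congr 1
        rw [indicatorFT, intervalIntegral.integral_of_le ht, ← integral_Icc_eq_integral_Ioc,
          ← integral_indicator measurableSet_Icc]
        congr 1; ext s
        by_cases hs : s ∈ Set.Icc 0 t <;> simp [hs]

theorem indicatorFT_eq_mul (t ω : ℝ) : indicatorFT t ω = t * indicatorFT 1 (t * ω) := by
  have h1 : ∀ s, expI (t * ω) s = expI ω (t * s) := fun s => by
    rw [expI, expI]; congr 1; push_cast; ring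
  have := intervalIntegral.smul_integral_comp_mul_left (expI ω) t (a := 0) (b := 1)
  simp only [mul_zero, mul_one, Complex.real_smul] at this
  rw [indicatorFT, indicatorFT, ← this]
  simp_rw [h1]

theorem norm_sq_indicatorFT (t ω : ℝ) :
    ‖indicatorFT t ω‖ ^ 2 = t ^ 2 * ‖indicatorFT 1 (t * ω)‖ ^ 2 := by
  rw [indicatorFT_eq_mul, norm_mul, mul_pow, Complex.norm_real, Real.norm_eq_abs, sq_abs]

theorem norm_indicatorFT_one_le (ω : ℝ) : ‖indicatorFT 1 ω‖ ≤ 1 := by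
  have := intervalIntegral.norm_integral_le_of_norm_le_const (a := 0) (b := 1) (C := 1)
    (f := expI ω) fun s _ => (norm_expI ω s).le
  simpa [indicatorFT] using this

theorem norm_indicatorFT_one_mul_le (ω : ℝ) : ‖indicatorFT 1 ω‖ * |ω| ≤ 2 := by
  rcases eq_or_ne ω 0 with rfl | hω
  · simp
  have hne : Complex.I * ω ≠ 0 := by simp [hω]
  have e : indicatorFT 1 ω = (expI ω 1 - 1) / (Complex.I * ω) := by
    have h1 : ∀ s : ℝ, expI ω s = Complex.exp (Complex.I * ω * s) := fun s => by
      rw [expI]; congr 1; ring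
    have := integral_exp_mul_complex (a := 0) (b := 1) hne
    rw [indicatorFT]
    simp_rw [h1]
    rw [this]
    simp
  rw [e, norm_div, norm_mul, Complex.norm_I, one_mul, Complex.norm_real, Real.norm_eq_abs,
    div_mul_cancel₀ _ (abs_pos.2 hω).ne']
  refine (norm_sub_le _ _).trans ?_
  rw [norm_expI, norm_one]; norm_num

theorem norm_sq_indicatorFT_one_le (ω : ℝ) :
    ‖indicatorFT 1 ω‖ ^ 2 ≤ 16 * ((1 + |ω|) ^ 2)⁻¹ := by
  have h0 := norm_nonneg (indicatorFT 1 ω)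
  have h1 := norm_indicatorFT_one_le ω
  have h2 := norm_indicatorFT_one_mul_le ω
  rw [← div_eq_mul_inv, le_div_iff₀ (by positivity), ← mul_pow]
  have h3 : ‖indicatorFT 1 ω‖ * (1 + |ω|) ≤ 3 := by linarith
  nlinarith [mul_nonneg h0 (show 0 ≤ 1 + |ω| by positivity)]

theorem one_add_posLog_abs_le (x : ℝ) : 1 + Real.posLog |x| ≤ 3 * (1 + |x|) ^ (1 / 2 : ℝ) := by
  have h1 : (1 : ℝ) ≤ 1 + |x| := by linarith [abs_nonneg x]
  have h2 : Real.posLog |x| ≤ Real.posLog (1 + |x|) :=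
    Real.posLog_le_posLog (abs_nonneg x) (by linarith)
  rw [Real.posLog_eq_log (h1.trans (le_abs_self _))] at h2
  have h3 := Real.log_le_rpow_div (x := 1 + |x|) (by positivity) (ε := 1 / 2) (by norm_num)
  have h4 : 1 ≤ (1 + |x|) ^ (1 / 2 : ℝ) := Real.one_le_rpow h1 (by norm_num)
  rw [div_div_eq_mul_div, div_one] at h3
  linarith

theorem integrable_indicatorFT_sq_mul_posLog :
    Integrable fun x : ℝ => ‖indicatorFT 1 x‖ ^ 2 * (1 + Real.posLog |x|) := by
  have hi : Integrable fun x : ℝ => (1 + ‖x‖) ^ (-(3 / 2) : ℝ) :=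
    integrable_one_add_norm (by norm_num)
  have hc := continuous_indicatorFT 1
  refine (hi.const_mul 48).mono' (Continuous.aestronglyMeasurable (by fun_prop))
    (Eventually.of_forall fun x => ?_)
  have hp := Real.posLog_nonneg (x := |x|)
  have hx : 0 < 1 + |x| := by positivity
  rw [Real.norm_of_nonneg (by positivity), Real.norm_eq_abs]
  have e : ((1 + |x|) ^ 2)⁻¹ * (1 + |x|) ^ (1 / 2 : ℝ) = (1 + |x|) ^ (-(3 / 2) : ℝ) := by
    rw [← Real.rpow_natCast, ← Real.rpow_neg hx.le, ← Real.rpow_add hx]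
    norm_num
  calc ‖indicatorFT 1 x‖ ^ 2 * (1 + Real.posLog |x|)
      ≤ (16 * ((1 + |x|) ^ 2)⁻¹) * (3 * (1 + |x|) ^ (1 / 2 : ℝ)) :=
        mul_le_mul (norm_sq_indicatorFT_one_le x) (one_add_posLog_abs_le x) (by positivity)
          (by positivity)
    _ = 48 * (((1 + |x|) ^ 2)⁻¹ * (1 + |x|) ^ (1 / 2 : ℝ)) := by ring
    _ = _ := by rw [e]

theorem integrable_indicatorFT_one_sq : Integrable fun x : ℝ => ‖indicatorFT 1 x‖ ^ 2 := by
  have hc := continuous_indicatorFT 1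
  refine integrable_indicatorFT_sq_mul_posLog.mono' (Continuous.aestronglyMeasurable (by fun_prop))
    (Eventually.of_forall fun x => ?_)
  rw [Real.norm_of_nonneg (by positivity)]
  exact le_mul_of_one_le_right (by positivity) (by linarith [Real.posLog_nonneg (x := |x|)])

theorem integrable_indicatorFT_sq (t : ℝ) : Integrable fun x : ℝ => ‖indicatorFT t x‖ ^ 2 := by
  simp_rw [norm_sq_indicatorFT t]
  rcases eq_or_ne t 0 with rfl | ht
  · simp
  · exact (integrable_indicatorFT_one_sq.comp_mul_left' ht).const_mul _

theorem integral_indicatorFT_one_sq_pos : 0 < ∫ x : ℝ, ‖indicatorFT 1 x‖ ^ 2 := by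
  have hc := continuous_indicatorFT 1
  refine integral_pos_of_integrable_nonneg_nonzero (x := 0) (by fun_prop)
    integrable_indicatorFT_one_sq (fun x => by positivity) ?_
  simp [indicatorFT, expI]

/-- Scaling limit of the Fejér-type integrals: if a density `r` decays like `c / log (1 / |ω|)` at
zero frequency, then `∫ r |F[1_{[0,t]}]|²` grows like `t / log t`. -/
theorem tendsto_integral_mul_indicatorFT_sq {r : ℝ → ℝ} (hr : Measurable r)
    (hnn : ∀ ω, ω ≠ 0 → 0 ≤ r ω) {M : ℝ}
    (hM : ∀ ω, ω ≠ 0 → r ω ≤ M ∧ r ω * Real.posLog |ω|⁻¹ ≤ M) {c : ℝ}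
    (hc : Tendsto (fun ω => r ω * Real.log |ω|⁻¹) (𝓝[≠] 0) (𝓝 c)) :
    Tendsto (fun t => (∫ ω, r ω * ‖indicatorFT t ω‖ ^ 2) / (t / Real.log t)) atTop
      (𝓝 (c * ∫ x, ‖indicatorFT 1 x‖ ^ 2)) := by
  have hcont := continuous_indicatorFT 1
  have scale : ∀ t : ℝ, 1 < t → ∫ x, (r (t⁻¹ * x) * Real.log t) * ‖indicatorFT 1 x‖ ^ 2 =
      (∫ ω, r ω * ‖indicatorFT t ω‖ ^ 2) / (t / Real.log t) := by
    intro t ht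
    have ht0 : 0 < t := by linarith
    have hl := Real.log_pos ht
    have e := Measure.integral_comp_mul_left
      (fun x => r (t⁻¹ * x) * Real.log t * ‖indicatorFT 1 x‖ ^ 2) t
    simp only [inv_mul_cancel_left₀ ht0.ne', abs_of_pos (inv_pos.2 ht0), smul_eq_mul] at e
    rw [inv_mul_eq_div, eq_div_iff ht0.ne'] at e
    rw [← e]
    have e2 : (∫ ω, r ω * ‖indicatorFT t ω‖ ^ 2) =
        (t ^ 2 / Real.log t) * ∫ x, r x * Real.log t * ‖indicatorFT 1 (t * x)‖ ^ 2 := by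
      rw [← integral_const_mul]
      congr 1; ext ω
      rw [norm_sq_indicatorFT t]
      field_simp
    rw [e2]
    generalize (∫ x, r x * Real.log t * ‖indicatorFT 1 (t * x)‖ ^ 2) = J
    field_simp
  have lim : Tendsto (fun t => ∫ x, (r (t⁻¹ * x) * Real.log t) * ‖indicatorFT 1 x‖ ^ 2) atTop
      (𝓝 (∫ x, c * ‖indicatorFT 1 x‖ ^ 2)) := by
    refine tendsto_integral_filter_of_dominated_convergence
      (fun x => M * (‖indicatorFT 1 x‖ ^ 2 * (1 + Real.posLog |x|))) ?_ ?_
      (integrable_indicatorFT_sq_mul_posLog.const_mul M) ?_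
    · refine Eventually.of_forall fun t => ?_
      exact (((hr.comp (measurable_const_mul t⁻¹)).mul_const _).mul
        (hcont.measurable.norm.pow_const 2)).aestronglyMeasurable
    · filter_upwards [eventually_gt_atTop 1] with t ht
      filter_upwards [Measure.ae_ne volume 0] with x hx
      have ht0 : 0 < t := by linarith
      have hl := Real.log_pos ht
      have hy : t⁻¹ * x ≠ 0 := mul_ne_zero (inv_pos.2 ht0).ne' hx
      have h0 := hnn _ hy
      obtain ⟨h1, h2⟩ := hM _ hy
      rw [Real.norm_of_nonneg (by positivity)]
      -- `log t` is at most `log⁺ |x| + log⁺ (t / |x|)`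
      have h3 : Real.log t ≤ Real.posLog |x| + Real.posLog |t⁻¹ * x|⁻¹ := by
        have e : |x| * |t⁻¹ * x|⁻¹ = t := by
          have := abs_pos.2 hx
          rw [abs_mul, abs_of_pos (inv_pos.2 ht0)]
          field_simp
        have := Real.posLog_mul (x := |x|) (y := |t⁻¹ * x|⁻¹)
        rw [e] at this
        exact (le_max_right _ _).trans this
      have hp := Real.posLog_nonneg (x := |x|)
      have h4 : r (t⁻¹ * x) * Real.log t ≤ M * (1 + Real.posLog |x|) := by
        have a1 := mul_le_mul_of_nonneg_left h3 h0
        have a2 := mul_le_mul_of_nonneg_right h1 hp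
        linarith
      have := mul_le_mul_of_nonneg_right h4 (sq_nonneg ‖indicatorFT 1 x‖)
      linarith
    · filter_upwards [Measure.ae_ne volume 0] with x hx
      refine Tendsto.mul_const _ ?_
      have hx' := abs_pos.2 hx
      have l0 : Tendsto (fun t : ℝ => t⁻¹ * x) atTop (𝓝[≠] 0) := by
        refine tendsto_nhdsWithin_iff.2 ⟨?_, ?_⟩
        · simpa using tendsto_inv_atTop_zero.mul_const x
        · filter_upwards [eventually_gt_atTop 0] with t ht
          exact mul_ne_zero (inv_pos.2 ht).ne' hx
      have l1 := hc.comp l0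
      have l2 : Tendsto (fun t => 1 - Real.log |x| / Real.log t) atTop (𝓝 (1 - 0)) :=
        tendsto_const_nhds.sub (tendsto_const_nhds.div_atTop Real.tendsto_log_atTop)
      have l3 := l1.div l2 (by norm_num)
      rw [sub_zero, div_one] at l3
      refine l3.congr' ?_
      filter_upwards [eventually_gt_atTop 1, eventually_gt_atTop |x|] with t ht htx
      have ht0 : 0 < t := by linarith
      have hl := Real.log_pos ht
      have hlt := Real.log_lt_log hx' htx
      have e : Real.log |t⁻¹ * x|⁻¹ = Real.log t - Real.log |x| := by
        rw [abs_mul, abs_of_pos (inv_pos.2 ht0), mul_inv, inv_inv,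
          Real.log_mul ht0.ne' (inv_pos.2 hx').ne', Real.log_inv]
        ring
      have hne : Real.log t - Real.log |x| ≠ 0 := by linarith
      simp only [Function.comp_apply, Pi.div_apply]
      rw [e, one_sub_div hl.ne']
      field_simp
  rw [integral_const_mul] at lim
  refine lim.congr' ?_
  filter_upwards [eventually_gt_atTop 1] with t ht using scale t ht

end GLE

theorem mainTheorem1 {Ω : Type*} [MeasurableSpace Ω] (P : Measure Ω) [IsProbabilityMeasure P]
    (m β : ℝ) (hm : 0 < m) (hβ : 0 < β)
    (K : ℝ → ℝ) (hK : GLE.IsMemoryKernel K)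
    (hKtail : GLE.AsympUpToConst K (fun t => t⁻¹) atTop)
    (ν : Measure ℝ) (V : 𝓢'(ℝ, ℂ) →ₗ.[ℂ] Lp ℂ 2 P)
    (hV : GLE.IsWeakSolution m β K P ν V) :
    (∀ t : ℝ, 0 ≤ t → GLE.indicatorDist t ∈ V.domain) ∧
      GLE.AsympUpToConst (fun t => ∫ x, ‖(GLE.position V t : Lp ℂ 2 P) x‖ ^ 2 ∂P)
        (fun t => t / Real.log t) atTop := by
  obtain ⟨c, hc0, hc⟩ := hKtail
  obtain ⟨A, C, h⟩ := hK.exists_tailBound hc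
  have hpos : ∀ ω, ω ≠ 0 → 0 < (GLE.halfFT K ω).re := fun ω hω => hK.halfFT_re_pos h hω
  obtain ⟨M, hM⟩ := h.exists_spectralDensity_le hm hβ hpos hc0 hc
  have hnn : ∀ ω, ω ≠ 0 → 0 ≤ GLE.spectralDensity m β K ω := fun ω hω =>
    GLE.spectralDensity_nonneg hβ hpos hω
  have hmem : ∀ t : ℝ, 0 ≤ t → GLE.indicatorDist t ∈ V.domain := fun t ht => by
    refine (hV.stationary.mem_domain _).2 ⟨_, GLE.isFunction_ftDist_indicatorDist ht, ?_⟩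
    rw [memLp_two_iff_integrable_sq_norm (GLE.continuous_indicatorFT t).aestronglyMeasurable,
      h.integrable_iff_spectralDensity hβ hK.even hpos hV]
    refine (GLE.integrable_indicatorFT_sq t).bdd_mul (c := M)
      (h.measurable_spectralDensity m β).aestronglyMeasurable ?_
    filter_upwards [Measure.ae_ne volume 0] with ω hω
    rw [Real.norm_of_nonneg (hnn ω hω)]
    exact (hM ω hω).1
  have hvar : ∀ t : ℝ, 0 ≤ t → ∫ x, ‖(GLE.position V t : Lp ℂ 2 P) x‖ ^ 2 ∂P =
      ∫ ω, GLE.spectralDensity m β K ω * ‖GLE.indicatorFT t ω‖ ^ 2 := fun t ht => by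
    have hf := GLE.isFunction_ftDist_indicatorDist ht
    have e := hV.stationary.covariance ⟨_, hmem t ht⟩ ⟨_, hmem t ht⟩ _ _ hf hf
    simp only [Complex.mul_conj', ← Complex.ofReal_pow] at e
    rw [integral_complex_ofReal, integral_complex_ofReal, Complex.ofReal_inj,
      h.integral_eq_spectralDensity hβ hK.even hpos hV] at e
    rw [← e, GLE.position, dif_pos (hmem t ht)]
  refine ⟨hmem, 1 / (Real.pi * β * c) * ∫ x, ‖GLE.indicatorFT 1 x‖ ^ 2, ?_, ?_⟩
  · have := GLE.integral_indicatorFT_one_sq_pos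
    have := Real.pi_pos
    positivity
  · refine (GLE.tendsto_integral_mul_indicatorFT_sq (h.measurable_spectralDensity m β) hnn hM
      (h.tendsto_spectralDensity_mul_log hβ hc0 hc)).congr' ?_
    filter_upwards [eventually_ge_atTop 0] with t ht
    rw [hvar t ht]
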